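/- Let $N\in\mathbb N$ and let $L:\mathbb R\to\mathbb R^{N\times N}$ be continuous with $L(t)$ symmetric for every $t$. Assume: (L1) there exist $\alpha>1$ and $M>0$ such that $$\lim_{R\to+\infty}\operatorname{meas}\Big(\Big\{t\in\mathbb R:\ |t|\ge R,\ \ \frac{(L(t)x,x)}{|t|\ln^{\alpha}|t|}\le M\ \text{ for some } x\in\mathbb R^N \text{ with } |x|=1\Big\}\Big)=0 ;$$ (L2) there exists $L_0>0$ such that $(L(t)x,x)\ge -L_0|x|^2$ for all $(t,x)\in\mathbb R\times\mathbb R^N$. Then the operator $-\frac{d^2}{dt^2}+L(t)$ on $C_c^\infty(\mathbb R,\mathbb R^N)$ has a self-adjoint extension in $L^2(\mathbb R,\mathbb R^N)$, and for every such extension $\mathcal H$ the following holds. Here $|\mathcal H|$ denotes the nonnegative self-adjoint operator with $|\mathcal H|^2=\mathcal H^2$, and $|\mathcal H|^{1/2}$ the nonnegative self-adjoint operator with square $|\mathcal H|$. Let $E=\mathfrak D(|\mathcal H|^{1/2})$ with the norm $$\|u\|=\big(\||\mathcal H|^{1/2}u\|_{L^2}^2+\|u^0\|_{L^2}^2\big)^{1/2},$$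 where $u^0$ is the $L^2$-orthogonal projection of $u$ onto $\ker\mathcal H$. Then for every $p\in[1,+\infty]$ one has $E\subset L^p(\mathbb R,\mathbb R^N)$, there is a constant $C_p>0$ with $$\|u\|_{L^p}\le C_p\|u\|\qquad\text{for all }u\in E,$$ and the embedding $E\hookrightarrow L^p(\mathbb R,\mathbb R^N)$ is compact, i.e. every $\|\cdot\|$-bounded subset of $E$ is relatively compact in $L^p(\mathbb R,\mathbb R^N)$. -/

import Mathlib

open MeasureTheory Filter Topology
open scoped ENNReal ContDiff

/-- The real Hilbert space `L²(ℝ, ℝ^N)`. -/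
abbrev L2Space (N : ℕ) : Type :=
  Lp (EuclideanSpace ℝ (Fin N)) 2 (volume : Measure ℝ)

/-- The quadratic form `(A x, x)` of a matrix on `ℝ^N`. -/
noncomputable def quadForm {N : ℕ} (A : Matrix (Fin N) (Fin N) ℝ)
    (x : EuclideanSpace ℝ (Fin N)) : ℝ :=
  inner ℝ (Matrix.toEuclideanCLM (𝕜 := ℝ) A x) x

/-- The new coercivity condition: for some `α > 1` and `M > 0`, the measure of the set of all `t`
with `|t| ≥ R` at which `L(t) / (|t| ln^α |t|)` fails to be `> M I_N`, that is, at which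
`(L(t) x, x) / (|t| ln^α |t|) ≤ M` for some unit vector `x`, tends to `0` as `R → +∞`. -/
def CoercivityCondition {N : ℕ} (L : ℝ → Matrix (Fin N) (Fin N) ℝ) : Prop :=
  ∃ α M : ℝ, 1 < α ∧ 0 < M ∧
    Tendsto (fun R : ℝ => volume {t : ℝ | R ≤ |t| ∧
      ∃ x : EuclideanSpace ℝ (Fin N), ‖x‖ = 1 ∧
        quadForm (L t) x / (|t| * Real.log |t| ^ α) ≤ M}) atTop (𝓝 0)

/-- The lower bound: `(L(t) x, x) ≥ -L₀ |x|²` for some `L₀ > 0`. -/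
def LowerBoundCondition {N : ℕ} (L : ℝ → Matrix (Fin N) (Fin N) ℝ) : Prop :=
  ∃ L₀ : ℝ, 0 < L₀ ∧ ∀ (t : ℝ) (x : EuclideanSpace ℝ (Fin N)), -L₀ * ‖x‖ ^ 2 ≤ quadForm (L t) x

/-- `H` is a self-adjoint extension in `L²(ℝ, ℝ^N)` of the differential operator
`-(d²/dt²) + L(t)` with domain `C_c^∞(ℝ, ℝ^N)`. -/
def IsSelfAdjointExtension {N : ℕ} (L : ℝ → Matrix (Fin N) (Fin N) ℝ)
    (H : L2Space N →ₗ.[ℝ] L2Space N) : Prop :=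
  IsSelfAdjoint H ∧
    ∀ φ : ℝ → EuclideanSpace ℝ (Fin N), ContDiff ℝ ∞ φ → HasCompactSupport φ →
      ∃ u : H.domain, ((u : L2Space N) : ℝ → EuclideanSpace ℝ (Fin N)) =ᵐ[volume] φ ∧
        (H u : ℝ → EuclideanSpace ℝ (Fin N)) =ᵐ[volume]
          fun t => -deriv (deriv φ) t + Matrix.toEuclideanCLM (𝕜 := ℝ) (L t) (φ t)

section Operators

variable {X : Type*} [NormedAddCommGroup X] [InnerProductSpace ℝ X] [CompleteSpace X]

/-- A nonnegative self-adjoint (possibly unbounded) operator. -/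
def IsNonnegSelfAdjoint (T : X →ₗ.[ℝ] X) : Prop :=
  IsSelfAdjoint T ∧ ∀ u : T.domain, 0 ≤ (inner ℝ (T u) (u : X) : ℝ)

/-- The graph of `T² = T ∘ T` on its natural domain `{u ∈ D(T) : T u ∈ D(T)}`. -/
def squareGraph (T : X →ₗ.[ℝ] X) : Set (X × X) :=
  {q | ∃ v : X, (q.1, v) ∈ T.graph ∧ (v, q.2) ∈ T.graph}

/-- `P = |H|` for a self-adjoint operator `H`: the (unique) nonnegative self-adjoint operator
with `P² = H²`, equality of domains included. -/
def IsOperatorAbs (H P : X →ₗ.[ℝ] X) : Prop :=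
  IsNonnegSelfAdjoint P ∧ squareGraph P = squareGraph H

/-- `B = P^{1/2}` for a nonnegative self-adjoint operator `P`: the (unique) nonnegative
self-adjoint operator with `B² = P`, equality of domains included. -/
def IsOperatorSqrt (P B : X →ₗ.[ℝ] X) : Prop :=
  IsNonnegSelfAdjoint B ∧ squareGraph B = (P.graph : Set (X × X))

/-- The null space `{u ∈ D(H) : H u = 0}`. -/
def nullSpace (H : X →ₗ.[ℝ] X) : Submodule ℝ X :=
  (LinearMap.ker H.toFun).map H.domain.subtype

/-- The norm `‖u‖ = (‖|H|^{1/2} u‖₂² + ‖u⁰‖₂²)^{1/2}` on `E = D(|H|^{1/2})`, where `B = |H|^{1/2}`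
and `u⁰` is the component of `u` in the null space of `H`. The eigenspaces of `H` being mutually
orthogonal, `u⁰` is the orthogonal projection of `u`. (The null space of a self-adjoint
operator is closed; the closure only makes the projection available for every `H`.) -/
noncomputable def energyNorm (H B : X →ₗ.[ℝ] X) (u : B.domain) : ℝ :=
  Real.sqrt (‖B u‖ ^ 2 + ‖(nullSpace H).topologicalClosure.starProjection (u : X)‖ ^ 2)

end Operators

/-! Shift the potential: with `c = L₀ + 1` the form of `Q = L + c` dominates `|x|²`, so `A = -d²/dt²
+ Q` on test functions is symmetric and at least `1`. Everything is read off from the form ball `W`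
of test functions with `(Aφ, φ) ≤ 1`.

Two facts about `W` carry the analysis. Its members are uniformly Hölder-1/2, because `∫|φ'|² ≤ 1`.
Their `L¹` tails are uniformly small: (L1) gives `|x|² ≤ k(t) (Q(t)x, x)` near infinity with `∫k`
arbitrarily small, where `k` is the indicator of the bad set plus `1 / (M |t| ln^α |t|)`, integrable
since `α > 1`; Cauchy–Schwarz then bounds `∫|φ|` by `√(∫k)`. Hence `W` is totally bounded in `L²`
(`totallyBounded_form_ball`), and on its closure `L²`-smallness forces `L^p`-smallness for every `p
≥ 1` (`exists_eLpNorm_le_of_mem_closure`).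

The range of `A` is dense, since a square integrable weak solution of `v'' = Qv` has `|v|²` convex
and integrable, so `v = 0`. Thus `A⁻¹` extends to a compact injective symmetric operator, which has
a Hilbert basis of eigenvectors `b i` with eigenvalues `1 / ν i` (`exists_spectral_decomposition`).
The diagonal operator with entries `ν i - c` is a self-adjoint extension. Conversely, pairing with
test functions shows that every self-adjoint extension `H` has the same eigenvectors and
eigenvalues, so `|H|` and `|H|^{1/2}` act on `b i` by `|ν i - c|` and its square root; no general
spectral theorem is needed.

Since `|ν i| → ∞`, the nonzero `ν i - c` stay away from `0`, and the energy norm controls `∑ ν i (b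
i, u)²` (`sum_le_energyNorm_sq`). So a small energy ball lies in the closure of `W`, and the two
facts give boundedness and compactness of the embedding. -/

set_option linter.unusedSectionVars false

/-! ### Diagonal operators in a Hilbert basis; eigenvectors of `|H|` and `|H|^{1/2}`. -/

section DiagonalOperator

variable {X : Type*} [NormedAddCommGroup X] [InnerProductSpace ℝ X] [CompleteSpace X]
variable {ι : Type*}

theorem HilbertBasis.summable_sq_coord (b : HilbertBasis ι ℝ X) (u : X) :
    Summable fun i => (inner ℝ (b i) u : ℝ) ^ 2 := by
  refine (b.summable_inner_mul_inner u u).congr fun i => ?_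
  rw [real_inner_comm, sq]

theorem HilbertBasis.exists_of_summable_sq (b : HilbertBasis ι ℝ X) {f : ι → ℝ}
    (hf : Summable fun i => f i ^ 2) : ∃ v : X, ∀ i, (inner ℝ (b i) v : ℝ) = f i := by
  have hm : Memℓp f 2 := by
    refine memℓp_gen ?_
    simpa using hf
  refine ⟨b.repr.symm ⟨f, hm⟩, fun i => ?_⟩
  rw [← b.repr_apply_apply, LinearIsometryEquiv.apply_symm_apply]

theorem HilbertBasis.ext_coord (b : HilbertBasis ι ℝ X) {u v : X}
    (h : ∀ i, (inner ℝ (b i) u : ℝ) = inner ℝ (b i) v) : u = v := by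
  apply b.repr.injective
  ext i
  rw [b.repr_apply_apply, b.repr_apply_apply, h i]

/-- The graph of the diagonal operator with eigenvalues `lam` in the Hilbert basis `b`. -/
def diagGraph (b : HilbertBasis ι ℝ X) (lam : ι → ℝ) : Submodule ℝ (X × X) where
  carrier := {q | ∀ i, (inner ℝ (b i) q.2 : ℝ) = lam i * inner ℝ (b i) q.1}
  zero_mem' := by intro i; simp
  add_mem' := by
    intro p q hp hq i
    simp only [Prod.snd_add, Prod.fst_add, inner_add_right, hp i, hq i, mul_add]
  smul_mem' := by
    intro a q hq i
    simp only [Prod.smul_snd, Prod.smul_fst, inner_smul_right, hq i]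
    ring

/-- The diagonal operator with eigenvalues `lam` in the Hilbert basis `b`, on its maximal domain. -/
noncomputable def diagOp (b : HilbertBasis ι ℝ X) (lam : ι → ℝ) : X →ₗ.[ℝ] X :=
  (diagGraph b lam).toLinearPMap

theorem graph_diagOp (b : HilbertBasis ι ℝ X) (lam : ι → ℝ) :
    (diagOp b lam).graph = diagGraph b lam := by
  refine Submodule.toLinearPMap_graph_eq _ fun x hx hx0 => ?_
  refine b.ext_coord fun i => ?_
  rw [hx i, hx0]
  simp

theorem mem_graph_diagOp (b : HilbertBasis ι ℝ X) (lam : ι → ℝ) (u v : X) :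
    (u, v) ∈ (diagOp b lam).graph ↔
      ∀ i, (inner ℝ (b i) v : ℝ) = lam i * inner ℝ (b i) u := by
  rw [graph_diagOp]
  rfl

theorem HilbertBasis.inner_self_ite [DecidableEq ι] (b : HilbertBasis ι ℝ X) (i j : ι) :
    (inner ℝ (b i) (b j) : ℝ) = if i = j then 1 else 0 :=
  orthonormal_iff_ite.1 b.orthonormal i j

theorem basis_mem_graph_diagOp (b : HilbertBasis ι ℝ X) (lam : ι → ℝ) (i : ι) :
    (b i, lam i • b i) ∈ (diagOp b lam).graph := by
  classical
  rw [mem_graph_diagOp]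
  intro j
  rw [inner_smul_right, b.inner_self_ite]
  split_ifs with h
  · rw [h]
  · simp

theorem dense_domain_diagOp (b : HilbertBasis ι ℝ X) (lam : ι → ℝ) :
    Dense ((diagOp b lam).domain : Set X) := by
  rw [Submodule.dense_iff_topologicalClosure_eq_top, eq_top_iff, ← b.dense_span]
  refine Submodule.topologicalClosure_mono (Submodule.span_le.2 ?_)
  rintro _ ⟨i, rfl⟩
  exact LinearPMap.mem_domain_of_mem_graph (basis_mem_graph_diagOp b lam i)

theorem graph_adjoint_of_isSelfAdjoint {H : X →ₗ.[ℝ] X} (hH : IsSelfAdjoint H) :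
    H.graph.adjoint = H.graph := by
  rw [← LinearPMap.adjoint_graph_eq_graph_adjoint hH.dense_domain,
    LinearPMap.isSelfAdjoint_def.1 hH]

theorem inner_comm_of_isSelfAdjoint {H : X →ₗ.[ℝ] X} (hH : IsSelfAdjoint H) {u v x y : X}
    (h : (u, v) ∈ H.graph) (h' : (x, y) ∈ H.graph) : (inner ℝ v x : ℝ) = inner ℝ u y := by
  rw [← graph_adjoint_of_isSelfAdjoint hH, Submodule.mem_adjoint_iff] at h'
  exact sub_eq_zero.1 (h' u v h)

/-- Testing the adjoint relation on the basis vectors alone already forces the diagonal form; the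
converse is Parseval. -/
theorem isSelfAdjoint_diagOp (b : HilbertBasis ι ℝ X) (lam : ι → ℝ) :
    IsSelfAdjoint (diagOp b lam) := by
  rw [LinearPMap.isSelfAdjoint_def]
  apply LinearPMap.eq_of_eq_graph
  rw [LinearPMap.adjoint_graph_eq_graph_adjoint (dense_domain_diagOp b lam)]
  ext ⟨x, y⟩
  rw [Submodule.mem_adjoint_iff, mem_graph_diagOp]
  constructor
  · intro h i
    have := h _ _ (basis_mem_graph_diagOp b lam i)
    rw [inner_smul_left] at this
    simpa using (sub_eq_zero.1 this).symm
  · intro h u v huv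
    rw [mem_graph_diagOp] at huv
    rw [sub_eq_zero]
    refine (b.hasSum_inner_mul_inner v x).unique ((b.hasSum_inner_mul_inner u y).congr_fun ?_)
    intro i
    rw [h i, real_inner_comm, huv i, real_inner_comm (b i) u]
    ring

theorem inner_nonneg_of_mem_graph_diagOp (b : HilbertBasis ι ℝ X) {lam : ι → ℝ}
    (hlam : ∀ i, 0 ≤ lam i) {u v : X} (h : (u, v) ∈ (diagOp b lam).graph) :
    0 ≤ (inner ℝ v u : ℝ) := by
  rw [mem_graph_diagOp] at h
  refine (b.hasSum_inner_mul_inner v u).nonneg fun i => ?_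
  rw [real_inner_comm, h i, mul_assoc]
  exact mul_nonneg (hlam i) (mul_self_nonneg _)

theorem isNonnegSelfAdjoint_diagOp (b : HilbertBasis ι ℝ X) {lam : ι → ℝ}
    (hlam : ∀ i, 0 ≤ lam i) : IsNonnegSelfAdjoint (diagOp b lam) :=
  ⟨isSelfAdjoint_diagOp b lam, fun u =>
    inner_nonneg_of_mem_graph_diagOp b hlam (LinearPMap.mem_graph _ u)⟩

theorem mem_squareGraph_diagOp (b : HilbertBasis ι ℝ X) (lam : ι → ℝ) (u w : X) :
    (u, w) ∈ squareGraph (diagOp b lam) ↔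
      ∀ i, (inner ℝ (b i) w : ℝ) = lam i ^ 2 * inner ℝ (b i) u := by
  constructor
  · rintro ⟨v, h1, h2⟩ i
    simp only [mem_graph_diagOp] at h1 h2
    rw [h2 i, h1 i]
    ring
  · intro h
    obtain ⟨v, hv⟩ := b.exists_of_summable_sq (f := fun i => lam i * inner ℝ (b i) u) (by
      -- The intermediate vector exists because `λ² ≤ 1 + λ⁴`: its coordinates are dominated by
      -- those of `u` and `w`.
      refine Summable.of_nonneg_of_le (fun i => sq_nonneg _) (fun i => ?_)
        ((b.summable_sq_coord u).add (b.summable_sq_coord w))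
      rw [h i]
      nlinarith [sq_nonneg (inner ℝ (b i) u : ℝ), sq_nonneg (lam i * inner ℝ (b i) u),
        mul_nonneg (sq_nonneg (inner ℝ (b i) u : ℝ)) (sq_nonneg (lam i ^ 2 - 1 / 2))])
    refine ⟨v, ?_, ?_⟩
    · exact (mem_graph_diagOp ..).2 hv
    · refine (mem_graph_diagOp ..).2 fun i => ?_
      dsimp only
      rw [hv i, h i]
      ring

theorem isOperatorAbs_diagOp (b : HilbertBasis ι ℝ X) (lam : ι → ℝ) :
    IsOperatorAbs (diagOp b lam) (diagOp b fun i => |lam i|) := by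
  refine ⟨isNonnegSelfAdjoint_diagOp b fun i => abs_nonneg _, ?_⟩
  ext ⟨u, w⟩
  simp only [mem_squareGraph_diagOp, sq_abs]

theorem isOperatorSqrt_diagOp (b : HilbertBasis ι ℝ X) {lam : ι → ℝ} (hlam : ∀ i, 0 ≤ lam i) :
    IsOperatorSqrt (diagOp b lam) (diagOp b fun i => √(lam i)) := by
  refine ⟨isNonnegSelfAdjoint_diagOp b fun i => Real.sqrt_nonneg _, ?_⟩
  ext ⟨u, w⟩
  rw [mem_squareGraph_diagOp, SetLike.mem_coe, mem_graph_diagOp]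
  simp only [Real.sq_sqrt (hlam _)]

/-- An eigenvector of `A²` for `a²`, `0 ≤ a`, is one of `A ≥ 0` for `a`. -/
theorem IsNonnegSelfAdjoint.eq_smul {A : X →ₗ.[ℝ] X} (hA : IsNonnegSelfAdjoint A) {e v : X} {a : ℝ}
    (ha : 0 ≤ a) (h1 : (e, v) ∈ A.graph) (h2 : (v, a ^ 2 • e) ∈ A.graph) : v = a • e := by
  rcases ha.eq_or_lt with rfl | ha
  · have := inner_comm_of_isSelfAdjoint hA.1 h1 h2
    simpa using this
  · have h3 : (v - a • e, (-a) • (v - a • e)) ∈ A.graph := by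
      have := A.graph.sub_mem h2 (A.graph.smul_mem a h1)
      convert this using 1
      ext
      · simp
      · simp only [Prod.snd_sub, Prod.smul_snd]
        module
    obtain ⟨z, hz1, hz2⟩ := LinearPMap.mem_graph_iff _ |>.1 h3
    have h4 := hA.2 z
    rw [hz2, hz1, inner_smul_left, real_inner_self_eq_norm_sq] at h4
    have h5 : ‖v - a • e‖ ^ 2 ≤ 0 := by
      simp only [map_neg, RCLike.conj_to_real] at h4
      nlinarith [sq_nonneg ‖v - a • e‖]
    have h6 : ‖v - a • e‖ = 0 := by nlinarith [norm_nonneg (v - a • e)]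
    exact sub_eq_zero.1 (norm_eq_zero.1 h6)

/-- If a self-adjoint operator acts diagonally on its domain, then the basis vectors are
eigenvectors. -/
theorem basis_mem_graph_of_coord {H : X →ₗ.[ℝ] X} (hH : IsSelfAdjoint H) (b : HilbertBasis ι ℝ X)
    {lam : ι → ℝ}
    (h : ∀ u v, (u, v) ∈ H.graph → ∀ i, (inner ℝ (b i) v : ℝ) = lam i * inner ℝ (b i) u) (i : ι) :
    (b i, lam i • b i) ∈ H.graph := by
  rw [← graph_adjoint_of_isSelfAdjoint hH, Submodule.mem_adjoint_iff]
  intro u v huv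
  rw [sub_eq_zero, inner_smul_right, real_inner_comm, h u v huv i, real_inner_comm]

/-- This and its analogue for the square root determine the operators on eigenvectors from the
defining relation of squares, so uniqueness of `|H|` and `|H|^{1/2}` is never invoked. -/
theorem IsOperatorAbs.mem_graph {H P : X →ₗ.[ℝ] X} (hP : IsOperatorAbs H P) {e : X} {a : ℝ}
    (h : (e, a • e) ∈ H.graph) : (e, |a| • e) ∈ P.graph := by
  have h1 : (e, |a| ^ 2 • e) ∈ squareGraph P := by
    rw [hP.2]
    refine ⟨a • e, h, ?_⟩
    have := H.graph.smul_mem a h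
    rwa [Prod.smul_mk, smul_smul, ← sq, ← sq_abs] at this
  obtain ⟨v, hv1, hv2⟩ := h1
  rwa [← hP.1.eq_smul (abs_nonneg a) hv1 hv2]

theorem IsOperatorSqrt.mem_graph {P B : X →ₗ.[ℝ] X} (hB : IsOperatorSqrt P B) {e : X} {a : ℝ}
    (ha : 0 ≤ a) (h : (e, a • e) ∈ P.graph) : (e, √a • e) ∈ B.graph := by
  have h1 : (e, a • e) ∈ squareGraph B := by
    rw [hB.2]
    exact h
  obtain ⟨v, hv1, hv2⟩ := h1
  dsimp only at hv1 hv2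
  rw [← Real.sq_sqrt ha] at hv2
  rwa [← hB.1.eq_smul (Real.sqrt_nonneg a) hv1 hv2]

theorem mem_nullSpace {H : X →ₗ.[ℝ] X} {e : X} (h : (e, (0 : X)) ∈ H.graph) : e ∈ nullSpace H := by
  obtain ⟨z, hz1, hz2⟩ := (LinearPMap.mem_graph_iff _).1 h
  exact ⟨z, hz2, hz1⟩

theorem sum_sq_inner_le_norm_sq (b : HilbertBasis ι ℝ X) (u : X) (F : Finset ι) :
    ∑ i ∈ F, (inner ℝ (b i) u : ℝ) ^ 2 ≤ ‖u‖ ^ 2 := by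
  simpa using b.orthonormal.sum_inner_products_le u (s := F)

/-- The energy norm controls the weighted sum of the squares of the coordinates. -/
theorem sum_le_energyNorm_sq {H P B : X →ₗ.[ℝ] X} (hP : IsOperatorAbs H P)
    (hB : IsOperatorSqrt P B) (b : HilbertBasis ι ℝ X) {lam : ι → ℝ}
    (hb : ∀ i, (b i, lam i • b i) ∈ H.graph) {δ c : ℝ} (hδ : 0 < δ) (hc : 0 ≤ c)
    (hgap : ∀ i, lam i ≠ 0 → δ ≤ |lam i|) (u : B.domain) (F : Finset ι) :
    ∑ i ∈ F, (lam i + c) * (inner ℝ (b i) (u : X) : ℝ) ^ 2 ≤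
      (1 + c / δ + c) * energyNorm H B u ^ 2 := by
  classical
  set K := (nullSpace H).topologicalClosure with hK
  set w := K.starProjection (u : X) with hw
  have hBi : ∀ i, (inner ℝ (b i) (B u) : ℝ) = √|lam i| * inner ℝ (b i) (u : X) := by
    intro i
    have h1 := hB.mem_graph (abs_nonneg _) (hP.mem_graph (hb i))
    have h2 := inner_comm_of_isSelfAdjoint hB.1.1 h1 (B.mem_graph u)
    rw [← h2, inner_smul_left]
    simp
  -- Projection onto the kernel preserves the coordinates along kernel eigenvectors, where `B u`
  -- carries no information.
  have hwi : ∀ i, lam i = 0 → (inner ℝ (b i) w : ℝ) = inner ℝ (b i) (u : X) := by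
    intro i hi
    have h1 : b i ∈ K := by
      refine (nullSpace H).le_topologicalClosure (mem_nullSpace ?_)
      simpa [hi] using hb i
    rw [hw, ← Submodule.inner_starProjection_left_eq_right,
      Submodule.starProjection_eq_self_iff.2 h1]
  have he : energyNorm H B u ^ 2 = ‖B u‖ ^ 2 + ‖w‖ ^ 2 := by
    rw [energyNorm, Real.sq_sqrt (by positivity)]
  have h1 := sum_sq_inner_le_norm_sq b (B u) F
  have h2 := sum_sq_inner_le_norm_sq b w F
  have hcδ : 0 ≤ c / δ := by positivity
  have h3 : ∑ i ∈ F, (lam i + c) * (inner ℝ (b i) (u : X) : ℝ) ^ 2 ≤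
      ∑ i ∈ F, ((1 + c / δ) * (inner ℝ (b i) (B u) : ℝ) ^ 2 + c * (inner ℝ (b i) w : ℝ) ^ 2) := by
    refine Finset.sum_le_sum fun i _ => ?_
    rw [hBi, mul_pow, Real.sq_sqrt (abs_nonneg _)]
    by_cases hi : lam i = 0
    · rw [hwi i hi, hi]
      simp
    -- Off the kernel the gap absorbs the shift: `c ≤ (c / δ) |λ|`.
    · have h4 : lam i + c ≤ (1 + c / δ) * |lam i| := by
        have h5 := mul_le_mul_of_nonneg_left (hgap i hi) hcδ
        rw [div_mul_cancel₀ _ hδ.ne'] at h5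
        nlinarith [le_abs_self (lam i)]
      have h6 := mul_le_mul_of_nonneg_right h4 (sq_nonneg (inner ℝ (b i) (u : X) : ℝ))
      nlinarith [mul_nonneg hc (sq_nonneg (inner ℝ (b i) w : ℝ))]
  rw [Finset.sum_add_distrib, ← Finset.mul_sum, ← Finset.mul_sum] at h3
  rw [he]
  have h7 := mul_le_mul_of_nonneg_left h1 (by positivity : 0 ≤ 1 + c / δ)
  have h8 := mul_le_mul_of_nonneg_left h2 hc
  nlinarith [sq_nonneg ‖B u‖, sq_nonneg ‖w‖, mul_nonneg hc (sq_nonneg ‖B u‖),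
    mul_nonneg hcδ (sq_nonneg ‖w‖)]

end DiagonalOperator

/-! ### Spectral decomposition of a compact inverse. -/

section CompactResolvent

universe u

variable {X : Type u} [NormedAddCommGroup X] [InnerProductSpace ℝ X] [CompleteSpace X]

/-- Hilbert bases of the eigenspaces are glued together: the eigenspaces are mutually orthogonal,
and by the spectral theorem their sum has trivial orthogonal complement. -/
theorem exists_hilbertBasis_of_isCompactOperator {T : X →L[ℝ] X} (hT : IsCompactOperator T)
    (hsymm : (T : X →ₗ[ℝ] X).IsSymmetric) :
    ∃ (ι : Type u) (b : HilbertBasis ι ℝ X) (μ : ι → ℝ), ∀ i, T (b i) = μ i • b i := by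
  set G : ℝ → Submodule ℝ X := fun μ => Module.End.eigenspace (T : X →ₗ[ℝ] X) μ with hG
  have hcl : ∀ μ, IsClosed (G μ : Set X) := by
    intro μ
    have : (G μ : Set X) = {x | T x = μ • x} := by
      ext x
      simp [hG]
    rw [this]
    exact isClosed_eq T.continuous (continuous_const_smul μ)
  have hcomplete : ∀ μ, CompleteSpace (G μ) := fun μ => (hcl μ).completeSpace_coe
  choose w b hb using fun μ => exists_hilbertBasis ℝ (G μ)
  have hon : Orthonormal ℝ fun a : Σ μ, w μ => (G a.1).subtypeₗᵢ (b a.1 a.2) :=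
    hsymm.orthogonalFamily_eigenspaces.orthonormal_sigma_orthonormal fun μ => (b μ).orthonormal
  have hbot : (Submodule.span ℝ
      (Set.range fun a : Σ μ, w μ => (G a.1).subtypeₗᵢ (b a.1 a.2)))ᗮ = ⊥ := by
    rw [eq_bot_iff, ← ContinuousLinearMap.orthogonalComplement_iSup_eigenspaces_eq_bot hT hsymm,
      ← Submodule.orthogonal_closure (Submodule.span ℝ _)]
    refine Submodule.orthogonal_le (iSup_le fun μ x hx => ?_)
    have h1 := (b μ).hasSum_repr ⟨x, hx⟩
    have h2 := h1.mapL (G μ).subtypeL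
    refine mem_closure_of_tendsto h2 (Eventually.of_forall fun s => ?_)
    refine Submodule.sum_mem _ fun i _ => ?_
    rw [map_smul]
    exact Submodule.smul_mem _ _ (Submodule.subset_span ⟨⟨μ, i⟩, rfl⟩)
  have hfin : ∀ a : Σ μ, w μ, T (b a.1 a.2 : X) = a.1 • (b a.1 a.2 : X) := fun a =>
    Module.End.mem_eigenspace_iff.1 (b a.1 a.2).2
  refine ⟨Σ μ, w μ, HilbertBasis.mkOfOrthogonalEqBot hon hbot, fun a => a.1, fun a => ?_⟩
  rw [HilbertBasis.coe_mkOfOrthogonalEqBot]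
  exact hfin a

/-- Infinitely many such eigenvalues would give images of orthonormal vectors at mutual distance at
least `η`, contradicting compactness. -/
theorem finite_eigenvalues_of_isCompactOperator {ι : Type*} {T : X →L[ℝ] X}
    (hT : IsCompactOperator T) (b : HilbertBasis ι ℝ X) {μ : ι → ℝ}
    (hb : ∀ i, T (b i) = μ i • b i) {η : ℝ} (hη : 0 < η) : {i | η ≤ |μ i|}.Finite := by
  classical
  by_contra hinf
  set e := Set.Infinite.natEmbedding _ hinf with he
  have hK := hT.isCompact_closure_image_closedBall 1
  have hmem : ∀ n, T (b (e n)) ∈ closure (T '' Metric.closedBall 0 1) := by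
    intro n
    refine subset_closure ⟨_, ?_, rfl⟩
    rw [mem_closedBall_zero_iff, b.orthonormal.1]
  obtain ⟨x, -, φ, hφ, hlim⟩ := hK.tendsto_subseq hmem
  obtain ⟨n, hn⟩ := Metric.cauchySeq_iff'.1 hlim.cauchySeq η hη
  have h1 := hn (n + 1) (Nat.le_succ n)
  set p : ι := (e (φ (n + 1))).1 with hp
  set q : ι := (e (φ n)).1 with hq
  have hpq : p ≠ q := by
    intro h
    have := hφ.injective (e.injective (Subtype.ext h))
    omega
  simp only [Function.comp_apply] at h1
  rw [dist_eq_norm, hb, hb] at h1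
  have h2 : (inner ℝ (b p) (μ p • b p - μ q • b q) : ℝ) = μ p := by
    rw [inner_sub_right, inner_smul_right, inner_smul_right, b.inner_self_ite,
      b.inner_self_ite, if_pos rfl, if_neg hpq]
    simp
  have h3 := abs_real_inner_le_norm (b p) (μ p • b p - μ q • b q)
  rw [h2, b.orthonormal.1 p, one_mul] at h3
  have h4 : η ≤ |μ p| := (e (φ (n + 1))).2
  linarith

/-- The spectral decomposition of the inverse of a symmetric operator `A ≥ 1` with dense range
whose form ball is totally bounded. The operator is given on an abstract space `D` of test vectors
which `j` sends to the Hilbert space. -/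
theorem exists_spectral_decomposition {D : Type*} [AddCommGroup D] [Module ℝ D] (j A : D →ₗ[ℝ] X)
    (hA : DenseRange A) (hj : DenseRange j)
    (hsymm : ∀ φ ψ, (inner ℝ (A φ) (j ψ) : ℝ) = inner ℝ (j φ) (A ψ))
    (hpos : ∀ φ, ‖j φ‖ ^ 2 ≤ (inner ℝ (A φ) (j φ) : ℝ))
    (hcomp : TotallyBounded (j '' {φ | (inner ℝ (A φ) (j φ) : ℝ) ≤ 1})) :
    ∃ (ι : Type u) (b : HilbertBasis ι ℝ X) (ν : ι → ℝ),
      (∀ u f : X, (∀ φ, (inner ℝ u (A φ) : ℝ) = inner ℝ f (j φ)) →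
        ∀ i, (inner ℝ (b i) f : ℝ) = ν i * inner ℝ (b i) u) ∧
      (∀ K, {i | |ν i| ≤ K}.Finite) ∧
      ∀ (u : X) (s : ℝ), s < 1 →
        (∀ F : Finset ι, ∑ i ∈ F, ν i * (inner ℝ (b i) u : ℝ) ^ 2 ≤ s) →
        u ∈ closure (j '' {φ | (inner ℝ (A φ) (j φ) : ℝ) ≤ 1}) := by
  have hnorm : ∀ φ, ‖j φ‖ ≤ ‖A φ‖ := by
    intro φ
    have h1 := hpos φ
    have h2 := real_inner_le_norm (A φ) (j φ)
    rcases (norm_nonneg (j φ)).eq_or_lt with h0 | h0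
    · rw [← h0]
      exact norm_nonneg _
    · exact le_of_mul_le_mul_right (by nlinarith) h0
  -- `T` is the inverse of `A`, extended by continuity from the dense range of `A`.
  set T : X →L[ℝ] X := j.extendOfNorm A with hTdef
  have hTA : ∀ φ, T (A φ) = j φ :=
    LinearMap.extendOfNorm_eq hA ⟨1, fun φ => by simpa using hnorm φ⟩
  have hTclosure : ∀ (U : Set X), IsOpen U → ∀ f ∈ U, T f ∈ closure (j '' {φ | A φ ∈ U}) := by
    intro U hU f hf
    have h1 : f ∈ closure (U ∩ Set.range A) := hA.open_subset_closure_inter hU hf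
    refine closure_mono ?_ (image_closure_subset_closure_image T.continuous ⟨f, h1, rfl⟩)
    rintro _ ⟨_, ⟨hφ, φ, rfl⟩, rfl⟩
    exact ⟨φ, hφ, (hTA φ).symm⟩
  have hTsymm : (T : X →ₗ[ℝ] X).IsSymmetric := by
    intro f g
    refine hA.induction_on (p := fun f => (inner ℝ (T f) g : ℝ) = inner ℝ f (T g)) f
      (isClosed_eq (by fun_prop) (by fun_prop)) fun φ => ?_
    refine hA.induction_on (p := fun g => (inner ℝ (T (A φ)) g : ℝ) = inner ℝ (A φ) (T g)) g
      (isClosed_eq (by fun_prop) (by fun_prop)) fun ψ => ?_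
    rw [hTA, hTA, hsymm]
  have hTcomp : IsCompactOperator T := by
    -- Radius `1/2` puts the closed ball inside the open unit ball, where `(Aφ, jφ) ≤ ‖Aφ‖² < 1`, so
    -- the approximants of `T f` come from the form ball.
    refine (isCompactOperator_iff_isCompact_closure_image_closedBall (T : X →ₗ[ℝ] X)
      (r := 1 / 2) (by norm_num)).2 ?_
    refine hcomp.closure.isCompact_of_isClosed isClosed_closure |>.of_isClosed_subset
      isClosed_closure (closure_minimal ?_ isClosed_closure)
    rintro _ ⟨f, hf, rfl⟩
    refine closure_mono (Set.image_mono fun φ hφ => ?_)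
      (hTclosure (Metric.ball 0 1) Metric.isOpen_ball f ?_)
    · have h1 : ‖A φ‖ < 1 := by simpa using hφ
      refine (real_inner_le_norm _ _).trans ?_
      nlinarith [hnorm φ, norm_nonneg (j φ), norm_nonneg (A φ)]
    · have h2 : ‖f‖ ≤ 1 / 2 := by simpa using hf
      rw [mem_ball_zero_iff]
      linarith
  have hTinj : ∀ x, T x = 0 → x = 0 := by
    intro x hx
    refine hj.eq_zero_of_inner_left ℝ ?_
    rintro φ
    have := hTsymm x (A φ)
    simp only [ContinuousLinearMap.coe_coe, hTA, hx, inner_zero_left] at this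
    exact this.symm
  obtain ⟨ι, b, μ, hb⟩ := exists_hilbertBasis_of_isCompactOperator hTcomp hTsymm
  have hμ : ∀ i, μ i ≠ 0 := by
    intro i hi
    have h1 : b i = 0 := hTinj _ (by rw [hb, hi, zero_smul])
    exact b.orthonormal.ne_zero i h1
  refine ⟨ι, b, fun i => (μ i)⁻¹, ?_, ?_, ?_⟩
  · intro u f huf i
    have h1 : ∀ g, (inner ℝ u g : ℝ) = inner ℝ f (T g) := by
      intro g
      refine hA.induction_on (p := fun g => (inner ℝ u g : ℝ) = inner ℝ f (T g)) g
        (isClosed_eq (by fun_prop) (by fun_prop)) fun φ => ?_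
      rw [huf, hTA]
    have h2 := h1 (b i)
    rw [hb, inner_smul_right] at h2
    rw [real_inner_comm f, real_inner_comm u, h2, inv_mul_cancel_left₀ (hμ i)]
  · intro K
    -- The maximum with `1` keeps the threshold positive when `K ≤ 0`.
    refine (finite_eigenvalues_of_isCompactOperator hTcomp b hb
      (η := (max K 1)⁻¹) (by positivity)).subset fun i hi => ?_
    simp only [Set.mem_ofPred_eq, abs_inv] at hi ⊢
    rw [inv_le_comm₀ (by positivity) (abs_pos.2 (hμ i))]
    exact hi.trans (le_max_left _ _)
  · intro u s hs hF
    refine isClosed_closure.mem_of_tendsto (b.hasSum_repr u) (Eventually.of_forall fun F => ?_)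
    -- `g` is the preimage under `T` of the truncated expansion of `u`, and `(g, T g) = ∑ ν i (b i,
    -- u)²`. The strict bound `s < 1` makes the condition on `g` open, so `g` can be approximated by
    -- some `Aφ` satisfying it.
    set g : X := ∑ i ∈ F, (b.repr u i * (μ i)⁻¹) • b i with hg
    have hTg : T g = ∑ i ∈ F, b.repr u i • b i := by
      rw [hg, map_sum]
      refine Finset.sum_congr rfl fun i _ => ?_
      rw [map_smul, hb, smul_smul, mul_assoc, inv_mul_cancel₀ (hμ i), mul_one]
    have hq : (inner ℝ g (T g) : ℝ) < 1 := by
      refine lt_of_eq_of_lt ?_ ((hF F).trans_lt hs)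
      rw [hTg, hg, b.orthonormal.inner_sum]
      refine Finset.sum_congr rfl fun i _ => ?_
      rw [b.repr_apply_apply]
      simp only [conj_trivial]
      ring
    have h1 := hTclosure {f | (inner ℝ f (T f) : ℝ) < 1}
      (isOpen_lt (by fun_prop) continuous_const) g hq
    rw [hTg] at h1
    refine closure_mono (Set.image_mono fun φ hφ => ?_) h1
    simp only [Set.mem_ofPred_eq, hTA] at hφ ⊢
    exact hφ.le

end CompactResolvent

/-! ### Du Bois-Reymond lemmas and square integrable weak solutions. -/

section DuBoisReymond

variable {E : Type*} [NormedAddCommGroup E] [InnerProductSpace ℝ E] [CompleteSpace E]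

theorem ContDiff.deriv_infty {F : Type*} [NormedAddCommGroup F] [NormedSpace ℝ F] {φ : ℝ → F}
    (h : ContDiff ℝ ∞ φ) : ContDiff ℝ ∞ (deriv φ) :=
  (contDiff_infty_iff_deriv.1 h).2

theorem ContDiff.differentiable_infty {F : Type*} [NormedAddCommGroup F] [NormedSpace ℝ F]
    {φ : ℝ → F} (h : ContDiff ℝ ∞ φ) : Differentiable ℝ φ :=
  (contDiff_infty_iff_deriv.1 h).1

theorem HasCompactSupport.exists_support_subset_Ioc {F : Type*} [Zero F] {ψ : ℝ → F}
    (hψ : HasCompactSupport ψ) : ∃ R : ℝ, 0 < R ∧ tsupport ψ ⊆ Set.Ioo (-R) R := by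
  obtain ⟨R, hR⟩ := hψ.isCompact.isBounded.subset_ball_lt 0 0
  refine ⟨R, hR.1, hR.2.trans ?_⟩
  rw [Real.ball_eq_Ioo]
  simp

/-- Zero mean is exactly what makes the primitive vanish to the right of the support as well. -/
theorem exists_primitive_hasCompactSupport {ψ : ℝ → ℝ} (h1 : ContDiff ℝ ∞ ψ)
    (h2 : HasCompactSupport ψ) (h3 : ∫ t, ψ t = 0) :
    ∃ η : ℝ → ℝ, ContDiff ℝ ∞ η ∧ HasCompactSupport η ∧ deriv η = ψ := by
  obtain ⟨R, hR, hs⟩ := h2.exists_support_subset_Ioc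
  have hs' : Function.support ψ ⊆ Set.Ioo (-R) R := (subset_tsupport ψ).trans hs
  have hd : ∀ t, HasDerivAt (fun t => ∫ x in (-R)..t, ψ x) (ψ t) t := fun t =>
    h1.continuous.integral_hasStrictDerivAt _ _ |>.hasDerivAt
  have hderiv : deriv (fun t => ∫ x in (-R)..t, ψ x) = ψ := funext fun t => (hd t).deriv
  refine ⟨fun t => ∫ x in (-R)..t, ψ x, ?_, ?_, hderiv⟩
  · rw [contDiff_infty_iff_deriv, hderiv]
    exact ⟨fun t => (hd t).differentiableAt, h1⟩
  · refine HasCompactSupport.intro (isCompact_Icc (a := -R) (b := R)) fun t ht => ?_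
    rw [Set.mem_Icc, not_and_or, not_le, not_le] at ht
    rcases ht with ht | ht
    · refine (intervalIntegral.integral_congr fun x hx => ?_).trans
        (intervalIntegral.integral_zero (E := ℝ))
      by_contra hne
      have h4 := hs' hne
      rw [Set.uIcc_of_ge ht.le] at hx
      exact absurd h4.1 (not_lt.2 hx.2)
    · rw [intervalIntegral.integral_eq_integral_of_support_subset, h3]
      exact hs'.trans fun x hx => ⟨hx.1, hx.2.le.trans ht.le⟩

theorem exists_test_integral_eq_one :
    ∃ ρ : ℝ → ℝ, ContDiff ℝ ∞ ρ ∧ HasCompactSupport ρ ∧ ∫ t, ρ t = 1 := by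
  let f : ContDiffBump (0 : ℝ) := ⟨1, 2, by norm_num, by norm_num⟩
  exact ⟨f.normed volume, f.contDiff_normed, f.hasCompactSupport_normed, f.integral_normed⟩

theorem MeasureTheory.LocallyIntegrable.intervalIntegrable' {h : ℝ → E} (hh : LocallyIntegrable h)
    (a b : ℝ) : IntervalIntegrable h volume a b :=
  hh.integrableOn_isCompact isCompact_uIcc |>.intervalIntegrable

theorem MeasureTheory.LocallyIntegrable.integrable_test_smul {h : ℝ → E} (hh : LocallyIntegrable h) {η : ℝ → ℝ}
    (h1 : Continuous η) (h2 : HasCompactSupport η) : Integrable fun t => η t • h t :=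
  hh.integrable_smul_left_of_hasCompactSupport h1 h2

/-- Subtracting `(∫ψ) ρ` from a test function `ψ`, with `∫ρ = 1`, leaves a derivative of a test
function; so `h` acts on `ψ` as the constant `∫ρh`. -/
theorem ae_eq_const_of_integral_deriv_smul_eq_zero {h : ℝ → E} (hh : LocallyIntegrable h)
    (h0 : ∀ η : ℝ → ℝ, ContDiff ℝ ∞ η → HasCompactSupport η → ∫ t, deriv η t • h t = 0) :
    ∃ c : E, h =ᵐ[volume] fun _ => c := by
  obtain ⟨ρ, hρ1, hρ2, hρ3⟩ := exists_test_integral_eq_one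
  refine ⟨∫ t, ρ t • h t, ae_eq_of_integral_contDiff_smul_eq hh (locallyIntegrable_const _) ?_⟩
  intro ψ hψ1 hψ2
  have iψ : Integrable ψ := hψ1.continuous.integrable_of_hasCompactSupport hψ2
  have iρ : Integrable ρ := hρ1.continuous.integrable_of_hasCompactSupport hρ2
  obtain ⟨η, hη1, hη2, hη3⟩ := exists_primitive_hasCompactSupport
    (ψ := fun t => ψ t - (∫ s, ψ s) * ρ t) (hψ1.sub (contDiff_const.mul hρ1))
    (hψ2.sub hρ2.mul_left) (by
      rw [integral_sub iψ (iρ.const_mul _), integral_const_mul, hρ3, mul_one, sub_self])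
  have h4 := h0 η hη1 hη2
  rw [hη3] at h4
  simp only [sub_smul, mul_smul] at h4
  rw [integral_sub (hh.integrable_test_smul hψ1.continuous hψ2)
    ((hh.integrable_test_smul hρ1.continuous hρ2).fun_smul _), integral_smul, sub_eq_zero] at h4
  rw [h4, integral_smul_const]

/-- As `g` is only locally integrable, this is integration by parts for absolutely continuous
functions combined with Lebesgue differentiation. -/
theorem integral_deriv_mul_primitive {g : ℝ → ℝ} (hg : LocallyIntegrable g) {η : ℝ → ℝ}
    (h1 : ContDiff ℝ ∞ η) (h2 : HasCompactSupport η) :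
    ∫ t, deriv η t * (∫ s in (0 : ℝ)..t, g s) = -∫ t, η t * g t := by
  obtain ⟨R, hR, hs⟩ := h2.exists_support_subset_Ioc
  have hs' : Function.support η ⊆ Set.Ioc (-R) R :=
    ((subset_tsupport η).trans hs).trans Set.Ioo_subset_Ioc_self
  have hs'' : Function.support (deriv η) ⊆ Set.Ioc (-R) R :=
    (support_deriv_subset.trans hs).trans Set.Ioo_subset_Ioc_self
  have e1 : η R = 0 := by
    by_contra hne
    exact (hs (subset_tsupport η hne)).2.false
  have e2 : η (-R) = 0 := by
    by_contra hne
    exact (hs (subset_tsupport η hne)).1.false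
  have hgi : IntervalIntegrable g volume (-R) R := hg.intervalIntegrable' _ _
  have hG : AbsolutelyContinuousOnInterval (fun t => ∫ s in (0 : ℝ)..t, g s) (-R) R :=
    hgi.absolutelyContinuousOnInterval_intervalIntegral (by
      rw [Set.uIcc_of_le (by linarith)]; constructor <;> linarith)
  have hη : AbsolutelyContinuousOnInterval η (-R) R :=
    (h1.of_le (by exact_mod_cast le_top)).contDiffOn.absolutelyContinuousOnInterval
  have key := hG.integral_mul_deriv_eq_deriv_mul hη
  rw [e1, e2, mul_zero, mul_zero, sub_zero, zero_sub] at key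
  have a1 : ∫ t, deriv η t * (∫ s in (0 : ℝ)..t, g s) =
      ∫ t in (-R)..R, (∫ s in (0 : ℝ)..t, g s) * deriv η t := by
    rw [← intervalIntegral.integral_eq_integral_of_support_subset
      ((Function.support_mul_subset_left _ _).trans hs'')]
    simp only [mul_comm]
  have a2 : ∫ t, η t * g t = ∫ t in (-R)..R, deriv (fun t => ∫ s in (0 : ℝ)..t, g s) t * η t := by
    rw [← intervalIntegral.integral_eq_integral_of_support_subset
      ((Function.support_mul_subset_left _ _).trans hs')]
    refine intervalIntegral.integral_congr_ae ?_
    filter_upwards [LocallyIntegrable.ae_hasDerivAt_integral hg] with t ht _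
    rw [(ht 0).deriv, mul_comm]
  rw [a1, a2, key]

theorem MeasureTheory.LocallyIntegrable.inner_left {g : ℝ → E} (hg : LocallyIntegrable g) (e : E) :
    LocallyIntegrable fun t => (inner ℝ e (g t) : ℝ) := by
  rw [locallyIntegrable_iff] at hg ⊢
  exact fun K hK => (hg K hK).const_inner e

theorem MeasureTheory.LocallyIntegrable.inner_primitive {g : ℝ → E} (hg : LocallyIntegrable g) (e : E) (t : ℝ) :
    (inner ℝ e (∫ s in (0 : ℝ)..t, g s) : ℝ) = ∫ s in (0 : ℝ)..t, (inner ℝ e (g s) : ℝ) :=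
  ((innerSL ℝ e).intervalIntegral_comp_comm (hg.intervalIntegrable' _ _)).symm

theorem MeasureTheory.LocallyIntegrable.continuous_intervalIntegral {g : ℝ → E} (hg : LocallyIntegrable g) :
    Continuous fun t => ∫ s in (0 : ℝ)..t, g s :=
  intervalIntegral.continuous_primitive (fun _ _ => hg.intervalIntegrable' _ _) 0

theorem integral_deriv_smul_primitive {g : ℝ → E} (hg : LocallyIntegrable g) {η : ℝ → ℝ}
    (h1 : ContDiff ℝ ∞ η) (h2 : HasCompactSupport η) :
    ∫ t, deriv η t • (∫ s in (0 : ℝ)..t, g s) = -∫ t, η t • g t := by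
  refine ext_inner_left ℝ fun e => ?_
  have i1 : Integrable fun t => deriv η t • (∫ s in (0 : ℝ)..t, g s) :=
    hg.continuous_intervalIntegral.locallyIntegrable.integrable_test_smul
      h1.deriv_infty.continuous h2.deriv
  have i2 : Integrable fun t => η t • g t := hg.integrable_test_smul h1.continuous h2
  rw [inner_neg_right, ← integral_inner i1, ← integral_inner i2]
  simp only [inner_smul_right, hg.inner_primitive]
  exact integral_deriv_mul_primitive (hg.inner_left e) h1 h2

/-- A weak solution of `v'' = g` is a classical primitive of a primitive of `g`. -/
theorem exists_primitive_of_weak_second_deriv {v g : ℝ → E} (hv : LocallyIntegrable v)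
    (hg : LocallyIntegrable g)
    (h : ∀ η : ℝ → ℝ, ContDiff ℝ ∞ η → HasCompactSupport η →
      ∫ t, deriv (deriv η) t • v t = ∫ t, η t • g t) :
    ∃ (V : ℝ → E) (a : E), v =ᵐ[volume] V ∧
      ∀ t, HasDerivAt V ((∫ s in (0 : ℝ)..t, g s) + a) t := by
  obtain ⟨ρ, hρ1, hρ2, hρ3⟩ := exists_test_integral_eq_one
  set G : ℝ → E := fun t => ∫ s in (0 : ℝ)..t, g s with hG
  have hGc : Continuous G := hg.continuous_intervalIntegral
  have hGl := hGc.locallyIntegrable (μ := volume)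
  set w : ℝ → E := fun t => ∫ s in (0 : ℝ)..t, G s with hw
  have hwl := (LocallyIntegrable.continuous_intervalIntegral hGl).locallyIntegrable (μ := volume)
  -- The double primitive `w` solves the same weak equation, so `v - w` has zero weak second
  -- derivative and must be affine.
  have hwη : ∀ η : ℝ → ℝ, ContDiff ℝ ∞ η → HasCompactSupport η →
      ∫ t, deriv (deriv η) t • w t = ∫ t, η t • g t := by
    intro η h1 h2
    rw [integral_deriv_smul_primitive hGl h1.deriv_infty h2.deriv,
      integral_deriv_smul_primitive hg h1 h2, neg_neg]
  have hl : LocallyIntegrable fun t => v t - w t := hv.sub hwl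
  have h0 : ∀ η : ℝ → ℝ, ContDiff ℝ ∞ η → HasCompactSupport η →
      ∫ t, deriv (deriv η) t • (v t - w t) = 0 := by
    intro η h1 h2
    have c1 := h1.deriv_infty.deriv_infty.continuous
    simp only [smul_sub]
    rw [integral_sub (hv.integrable_test_smul c1 h2.deriv.deriv)
      (hwl.integrable_test_smul c1 h2.deriv.deriv), h η h1 h2, hwη η h1 h2, sub_self]
  -- `-k` is the slope of the affine function `v - w`: adding `t k` leaves a function with zero weak
  -- derivative.
  set k : E := ∫ t, deriv ρ t • (v t - w t) with hk
  have hlin : ∀ t : ℝ, (∫ _ in (0 : ℝ)..t, k) = t • k := by simp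
  have hlc : Continuous fun t : ℝ => t • k := by fun_prop
  obtain ⟨c, hc⟩ := ae_eq_const_of_integral_deriv_smul_eq_zero
    (h := fun t => (v t - w t) + t • k) (hl.add hlc.locallyIntegrable) (by
    intro ψ hψ1 hψ2
    have iψ : Integrable ψ := hψ1.continuous.integrable_of_hasCompactSupport hψ2
    have iρ : Integrable ρ := hρ1.continuous.integrable_of_hasCompactSupport hρ2
    have c1 := hψ1.deriv_infty.continuous
    obtain ⟨η, hη1, hη2, hη3⟩ := exists_primitive_hasCompactSupport
      (ψ := fun t => ψ t - (∫ s, ψ s) * ρ t) (hψ1.sub (contDiff_const.mul hρ1))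
      (hψ2.sub hρ2.mul_left) (by
        rw [integral_sub iψ (iρ.const_mul _), integral_const_mul, hρ3, mul_one, sub_self])
    have h4 := h0 η hη1 hη2
    have h5 : deriv (deriv η) = fun t => deriv ψ t - (∫ s, ψ s) * deriv ρ t := by
      rw [hη3]
      funext t
      exact ((hψ1.differentiable_infty t).hasDerivAt.sub
        ((hρ1.differentiable_infty t).hasDerivAt.const_mul _)).deriv
    rw [h5] at h4
    simp only [sub_smul, mul_smul] at h4
    rw [integral_sub (hl.integrable_test_smul c1 hψ2.deriv)
      ((hl.integrable_test_smul hρ1.deriv_infty.continuous hρ2.deriv).fun_smul _), integral_smul,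
      sub_eq_zero, ← hk] at h4
    have h6 := integral_deriv_smul_primitive (locallyIntegrable_const k) hψ1 hψ2
    simp only [hlin] at h6
    rw [integral_smul_const] at h6
    simp only [smul_add]
    rw [integral_add (hl.integrable_test_smul c1 hψ2.deriv)
      (hlc.locallyIntegrable.integrable_test_smul c1 hψ2.deriv), h4, h6, add_neg_cancel])
  refine ⟨fun t => w t + c - t • k, -k, ?_, fun t => ?_⟩
  · filter_upwards [hc] with t ht
    rw [← ht]
    abel
  · have d1 : HasDerivAt w (G t) t := (hGc.integral_hasStrictDerivAt 0 t).hasDerivAt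
    have d2 : HasDerivAt (fun t : ℝ => t • k) ((1 : ℝ) • k) t := (hasDerivAt_id t).smul_const k
    have d3 := (d1.add_const c).sub d2
    rw [one_smul] at d3
    rw [← sub_eq_add_neg]
    exact d3

/-- Convexity gives `2 f(a) ≤ f(a + s) + f(a - s)`, whose right side is integrable in `s`, whereas a
positive constant is not. -/
theorem ConvexOn.eq_zero_of_integrable {f : ℝ → ℝ} (hf : ConvexOn ℝ Set.univ f)
    (h0 : ∀ t, 0 ≤ f t) (hi : Integrable f) (a : ℝ) : f a = 0 := by
  by_contra hne
  have hpos : 0 < f a := lt_of_le_of_ne (h0 a) (Ne.symm hne)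
  have h1 : Integrable fun s => f (a + s) + f (a - s) :=
    (hi.comp_add_left a).add (hi.comp_sub_left a)
  have h2 : Integrable fun _ : ℝ => 2 * f a := by
    refine h1.mono' (by fun_prop) (Eventually.of_forall fun s => ?_)
    have h3 := hf.2 (Set.mem_univ (a + s)) (Set.mem_univ (a - s))
      (by norm_num : (0 : ℝ) ≤ 1 / 2) (by norm_num : (0 : ℝ) ≤ 1 / 2) (by norm_num)
    have h4 : (1 / 2 : ℝ) • (a + s) + (1 / 2 : ℝ) • (a - s) = a := by
      simp only [smul_eq_mul]; ring
    rw [h4] at h3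
    simp only [smul_eq_mul] at h3
    rw [Real.norm_of_nonneg (by positivity)]
    linarith
  rw [integrable_const_iff] at h2
  rcases h2 with h2 | h2
  · linarith
  · simp [isFiniteMeasure_iff] at h2

/-- A square integrable weak solution of `v'' = Q v`, `Q ≥ 0`, vanishes. -/
theorem ae_eq_zero_of_weak_solution {Q : ℝ → E →L[ℝ] E} (hQ : Continuous Q)
    (hsymm : ∀ t x y, (inner ℝ (Q t x) y : ℝ) = inner ℝ x (Q t y))
    (hpos : ∀ t x, 0 ≤ (inner ℝ (Q t x) x : ℝ)) {v : ℝ → E} (hv : MemLp v 2)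
    (h : ∀ φ : ℝ → E, ContDiff ℝ ∞ φ → HasCompactSupport φ →
      ∫ t, (inner ℝ (v t) (-deriv (deriv φ) t + Q t (φ t)) : ℝ) = 0) :
    v =ᵐ[volume] 0 := by
  have hvl : LocallyIntegrable v := hv.locallyIntegrable (by norm_num)
  have hgl : LocallyIntegrable fun t => Q t (v t) := by
    rw [locallyIntegrable_iff] at hvl ⊢
    intro K hK
    obtain ⟨C, hC⟩ := hK.exists_bound_of_continuousOn hQ.continuousOn
    refine ((hvl K hK).norm.const_mul C).mono' ?_ ?_
    · exact (ContinuousLinearMap.id ℝ (E →L[ℝ] E)).aestronglyMeasurable_comp₂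
        hQ.aestronglyMeasurable (hvl K hK).aestronglyMeasurable
    · refine (ae_restrict_iff' hK.measurableSet).2 (Eventually.of_forall fun t ht => ?_)
      exact (Q t).le_of_opNorm_le (hC t ht) _
  obtain ⟨V, a, hVv, hV⟩ := exists_primitive_of_weak_second_deriv hvl hgl (by
    intro η h1 h2
    refine ext_inner_left ℝ fun e => ?_
    have i1 := hvl.integrable_test_smul h1.deriv_infty.deriv_infty.continuous h2.deriv.deriv
    have i2 := hgl.integrable_test_smul h1.continuous h2
    rw [← integral_inner i1, ← integral_inner i2, ← sub_eq_zero, ← integral_sub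
      (i1.const_inner e) (i2.const_inner e), ← neg_eq_zero, ← integral_neg]
    -- Vector test functions `η e` with `e` fixed reduce the hypothesis to scalar test functions.
    rw [← h (fun t => η t • e) (h1.smul contDiff_const) h2.smul_right]
    refine integral_congr_ae (Eventually.of_forall fun t => ?_)
    have d1 : deriv (fun t => η t • e) = fun t => deriv η t • e := funext fun t =>
      ((h1.differentiable_infty t).hasDerivAt.smul_const e).deriv
    have d2 : deriv (deriv fun t => η t • e) t = deriv (deriv η) t • e := by
      rw [d1]
      exact ((h1.deriv_infty.differentiable_infty t).hasDerivAt.smul_const e).deriv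
    dsimp only
    rw [d2, inner_add_right, inner_neg_right, map_smul, inner_smul_right, inner_smul_right,
      inner_smul_right, inner_smul_right, ← hsymm, real_inner_comm e,
      real_inner_comm (v t) (Q t e)]
    ring)
  have hVc : Continuous V := continuous_iff_continuousAt.2 fun t => (hV t).continuousAt
  have hQV : Continuous fun t => Q t (V t) := hQ.clm_apply hVc
  have hGV : ∀ t, (∫ s in (0 : ℝ)..t, Q s (v s)) = ∫ s in (0 : ℝ)..t, Q s (V s) := by
    intro t
    refine intervalIntegral.integral_congr_ae ?_
    filter_upwards [hVv] with s hs _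
    rw [hs]
  set W : ℝ → E := fun t => (∫ s in (0 : ℝ)..t, Q s (V s)) + a with hW
  have hV' : ∀ t, HasDerivAt V (W t) t := fun t => by
    have := hV t
    rwa [hGV] at this
  have hW' : ∀ t, HasDerivAt W (Q t (V t)) t := fun t =>
    (hQV.integral_hasStrictDerivAt 0 t).hasDerivAt.add_const a
  have e1 : ∀ t, HasDerivAt (fun t => (inner ℝ (V t) (V t) : ℝ)) (2 * inner ℝ (V t) (W t)) t := by
    intro t
    have := (hV' t).inner ℝ (hV' t)
    rwa [real_inner_comm (V t) (W t), ← two_mul] at this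
  have e2 : ∀ t, HasDerivAt (fun t => 2 * (inner ℝ (V t) (W t) : ℝ))
      (2 * (inner ℝ (V t) (Q t (V t)) + inner ℝ (W t) (W t))) t := fun t =>
    ((hV' t).inner ℝ (hW' t)).const_mul 2
  have d1 : deriv (fun t => (inner ℝ (V t) (V t) : ℝ)) = fun t => 2 * (inner ℝ (V t) (W t) : ℝ) :=
    funext fun t => (e1 t).deriv
  -- The second derivative of `|V|²` is `2 ((QV, V) + |V'|²) ≥ 0`.
  have hconv : ConvexOn ℝ Set.univ fun t => (inner ℝ (V t) (V t) : ℝ) := by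
    refine convexOn_univ_of_deriv2_nonneg (fun t => (e1 t).differentiableAt) ?_ fun t => ?_
    · rw [d1]
      exact fun t => (e2 t).differentiableAt
    · rw [Function.iterate_succ, Function.iterate_one, Function.comp_apply, d1, (e2 t).deriv,
        ← hsymm]
      have := hpos t (V t)
      have := real_inner_self_nonneg (F := E) (x := W t)
      linarith
  have hint : Integrable fun t => (inner ℝ (V t) (V t) : ℝ) := by
    have := (hv.ae_eq hVv).integrable_norm_pow (by norm_num)
    simpa [real_inner_self_eq_norm_sq] using this
  have hzero := hconv.eq_zero_of_integrable (fun t => real_inner_self_nonneg) hint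
  filter_upwards [hVv] with t ht
  rw [ht]
  exact inner_self_eq_zero.1 (hzero t)

end DuBoisReymond

/-! ### The operator on test functions: form, symmetry, density of the range. -/

section TestFunctions

variable {E : Type*} [NormedAddCommGroup E] [InnerProductSpace ℝ E] [CompleteSpace E]

/-- The space of continuous compactly supported functions on the line. -/
def compactlySupportedSpace (E : Type*) [NormedAddCommGroup E] [InnerProductSpace ℝ E] :
    Submodule ℝ (ℝ → E) where
  carrier := {f | Continuous f ∧ HasCompactSupport f}
  zero_mem' := ⟨continuous_zero, HasCompactSupport.zero⟩
  add_mem' := fun hf hg => ⟨hf.1.add hg.1, hf.2.add hg.2⟩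
  smul_mem' := fun c _ hf => ⟨hf.1.const_smul c, hf.2.smul_left (f := fun _ => c)⟩

/-- The space of test functions on the line. -/
def testSpace (E : Type*) [NormedAddCommGroup E] [InnerProductSpace ℝ E] :
    Submodule ℝ (ℝ → E) where
  carrier := {φ | ContDiff ℝ ∞ φ ∧ HasCompactSupport φ}
  zero_mem' := ⟨contDiff_const, HasCompactSupport.zero⟩
  add_mem' := fun hf hg => ⟨hf.1.add hg.1, hf.2.add hg.2⟩
  smul_mem' := fun c _ hf => ⟨contDiff_const.smul hf.1, hf.2.smul_left (f := fun _ => c)⟩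

theorem testSpace_le : testSpace E ≤ compactlySupportedSpace E :=
  fun _ h => ⟨h.1.continuous, h.2⟩

theorem memLp_of_mem_compactlySupportedSpace (p : ℝ≥0∞) {f : ℝ → E}
    (hf : f ∈ compactlySupportedSpace E) : MemLp f p :=
  hf.1.memLp_of_hasCompactSupport hf.2

/-- The class in `L²` of a continuous compactly supported function. -/
noncomputable def compactlySupportedToL2 (E : Type*) [NormedAddCommGroup E]
    [InnerProductSpace ℝ E] [CompleteSpace E] :
    compactlySupportedSpace E →ₗ[ℝ] Lp E 2 (volume : Measure ℝ) where
  toFun f := (memLp_of_mem_compactlySupportedSpace 2 f.2).toLp f.1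
  map_add' _ _ := rfl
  map_smul' _ _ := rfl

/-- The class in `L²` of a test function. -/
noncomputable def testToL2 (E : Type*) [NormedAddCommGroup E] [InnerProductSpace ℝ E]
    [CompleteSpace E] : testSpace E →ₗ[ℝ] Lp E 2 (volume : Measure ℝ) :=
  compactlySupportedToL2 E ∘ₗ Submodule.inclusion testSpace_le

theorem coeFn_testToL2 (φ : testSpace E) : testToL2 E φ =ᵐ[volume] φ.1 :=
  MemLp.coeFn_toLp (memLp_of_mem_compactlySupportedSpace 2 (testSpace_le φ.2))

theorem operator_mem {Q : ℝ → E →L[ℝ] E} (hQ : Continuous Q) {φ : ℝ → E} (hφ : φ ∈ testSpace E) :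
    (fun t => -deriv (deriv φ) t + Q t (φ t)) ∈ compactlySupportedSpace E := by
  refine ⟨hφ.1.deriv_infty.deriv_infty.continuous.neg.add (hQ.clm_apply hφ.1.continuous),
    HasCompactSupport.add (f := fun t => -deriv (deriv φ) t) hφ.2.deriv.deriv.neg ?_⟩
  exact hφ.2.mono fun t ht h0 => ht (by simp [h0])

/-- The operator `-d²/dt² + Q(t)` from test functions to `L²`. -/
noncomputable def schrodingerOp {Q : ℝ → E →L[ℝ] E} (hQ : Continuous Q) :
    testSpace E →ₗ[ℝ] Lp E 2 (volume : Measure ℝ) :=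
  compactlySupportedToL2 E ∘ₗ
    { toFun := fun φ => ⟨fun t => -deriv (deriv φ.1) t + Q t (φ.1 t), operator_mem hQ φ.2⟩
      map_add' := fun φ ψ => by
        ext t
        have h1 : deriv (φ.1 + ψ.1) = deriv φ.1 + deriv ψ.1 := funext fun t =>
          deriv_add (φ.2.1.differentiable_infty t) (ψ.2.1.differentiable_infty t)
        have h2 : deriv (deriv φ.1 + deriv ψ.1) t = deriv (deriv φ.1) t + deriv (deriv ψ.1) t :=
          deriv_add (φ.2.1.deriv_infty.differentiable_infty t)
            (ψ.2.1.deriv_infty.differentiable_infty t)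
        simp only [Submodule.coe_add, Pi.add_apply, h1, h2, map_add]
        abel
      map_smul' := fun c φ => by
        ext t
        have h1 : deriv (c • φ.1) = c • deriv φ.1 := funext fun t =>
          deriv_const_smul c (φ.2.1.differentiable_infty t)
        have h2 : deriv (c • deriv φ.1) t = c • deriv (deriv φ.1) t :=
          deriv_const_smul c (φ.2.1.deriv_infty.differentiable_infty t)
        simp only [Submodule.coe_smul, Pi.smul_apply, h1, h2, map_smul, RingHom.id_apply,
          smul_add, smul_neg] }

theorem coeFn_schrodingerOp {Q : ℝ → E →L[ℝ] E} (hQ : Continuous Q) (φ : testSpace E) :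
    schrodingerOp hQ φ =ᵐ[volume] fun t => -deriv (deriv φ.1) t + Q t (φ.1 t) :=
  MemLp.coeFn_toLp (memLp_of_mem_compactlySupportedSpace 2 (operator_mem hQ φ.2))

theorem integrable_inner_of_hasCompactSupport {f g : ℝ → E} (hf : Continuous f)
    (hf' : HasCompactSupport f) (hg : Continuous g) :
    Integrable fun t => (inner ℝ (f t) (g t) : ℝ) := by
  refine (hf.inner hg).integrable_of_hasCompactSupport (hf'.mono fun t ht h0 => ht ?_)
  simp [h0]

theorem inner_schrodingerOp {Q : ℝ → E →L[ℝ] E} (hQ : Continuous Q) (φ ψ : testSpace E) :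
    (inner ℝ (schrodingerOp hQ φ) (testToL2 E ψ) : ℝ) =
      ∫ t, ((inner ℝ (deriv φ.1 t) (deriv ψ.1 t) : ℝ) + inner ℝ (Q t (φ.1 t)) (ψ.1 t)) := by
  have c1 := φ.2.1.deriv_infty.continuous
  have c2 := φ.2.1.deriv_infty.deriv_infty.continuous
  have c3 := ψ.2.1.continuous
  have c4 := ψ.2.1.deriv_infty.continuous
  have i1 : Integrable fun t => (inner ℝ (deriv φ.1 t) (deriv ψ.1 t) : ℝ) :=
    integrable_inner_of_hasCompactSupport c1 φ.2.2.deriv c4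
  have i2 : Integrable fun t => (inner ℝ (Q t (φ.1 t)) (ψ.1 t) : ℝ) := by
    refine integrable_inner_of_hasCompactSupport (hQ.clm_apply φ.2.1.continuous)
      (φ.2.2.mono fun t ht h0 => ht ?_) c3
    simp [h0]
  have i3 : Integrable fun t => (inner ℝ (deriv (deriv φ.1) t) (ψ.1 t) : ℝ) :=
    integrable_inner_of_hasCompactSupport c2 φ.2.2.deriv.deriv c3
  have i4 : Integrable fun t => (inner ℝ (deriv φ.1 t) (ψ.1 t) : ℝ) :=
    integrable_inner_of_hasCompactSupport c1 φ.2.2.deriv c3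
  have ibp : ∫ t, (inner ℝ (deriv φ.1 t) (deriv ψ.1 t) : ℝ) =
      -∫ t, (inner ℝ (deriv (deriv φ.1) t) (ψ.1 t) : ℝ) :=
    integral_bilinear_hasDerivAt_right_eq_neg_left_of_integrable (L := innerSL ℝ)
      (fun t _ => (φ.2.1.deriv_infty.differentiable_infty t).hasDerivAt)
      (fun t _ => (ψ.2.1.differentiable_infty t).hasDerivAt) i1 i3 i4
  rw [integral_add i1 i2, ibp, ← integral_neg, ← integral_add i3.fun_neg i2, L2.inner_def]
  refine integral_congr_ae ?_
  filter_upwards [coeFn_schrodingerOp hQ φ, coeFn_testToL2 ψ] with t h1 h2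
  rw [h1, h2, inner_add_left, inner_neg_left]

theorem inner_schrodingerOp_symm {Q : ℝ → E →L[ℝ] E} (hQ : Continuous Q)
    (hsymm : ∀ t x y, (inner ℝ (Q t x) y : ℝ) = inner ℝ x (Q t y)) (φ ψ : testSpace E) :
    (inner ℝ (schrodingerOp hQ φ) (testToL2 E ψ) : ℝ) =
      inner ℝ (testToL2 E φ) (schrodingerOp hQ ψ) := by
  rw [← real_inner_comm (testToL2 E φ), inner_schrodingerOp, inner_schrodingerOp]
  refine integral_congr_ae (Eventually.of_forall fun t => ?_)
  dsimp only
  rw [hsymm, real_inner_comm, real_inner_comm (φ.1 t)]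

theorem norm_sq_testToL2 (φ : testSpace E) : ‖testToL2 E φ‖ ^ 2 = ∫ t, ‖φ.1 t‖ ^ 2 := by
  rw [← real_inner_self_eq_norm_sq, L2.inner_def]
  refine integral_congr_ae ?_
  filter_upwards [coeFn_testToL2 φ] with t h
  rw [h, real_inner_self_eq_norm_sq]

theorem integrable_norm_sq_test {f : ℝ → E} (h1 : Continuous f) (h2 : HasCompactSupport f) :
    Integrable fun t => ‖f t‖ ^ 2 := by
  simpa [real_inner_self_eq_norm_sq] using integrable_inner_of_hasCompactSupport h1 h2 h1

theorem integrable_form {Q : ℝ → E →L[ℝ] E} (hQ : Continuous Q) (φ : testSpace E) :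
    Integrable fun t => (inner ℝ (Q t (φ.1 t)) (φ.1 t) : ℝ) := by
  refine integrable_inner_of_hasCompactSupport (hQ.clm_apply φ.2.1.continuous)
    (φ.2.2.mono fun t ht h0 => ht ?_) φ.2.1.continuous
  simp [h0]

theorem form_eq {Q : ℝ → E →L[ℝ] E} (hQ : Continuous Q) (φ : testSpace E) :
    (inner ℝ (schrodingerOp hQ φ) (testToL2 E φ) : ℝ) =
      (∫ t, ‖deriv φ.1 t‖ ^ 2) + ∫ t, (inner ℝ (Q t (φ.1 t)) (φ.1 t) : ℝ) := by
  rw [inner_schrodingerOp, ← integral_add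
    (integrable_norm_sq_test φ.2.1.deriv_infty.continuous φ.2.2.deriv) (integrable_form hQ φ)]
  simp only [real_inner_self_eq_norm_sq]

theorem norm_sq_le_form {Q : ℝ → E →L[ℝ] E} (hQ : Continuous Q)
    (hpos : ∀ t x, ‖x‖ ^ 2 ≤ (inner ℝ (Q t x) x : ℝ)) (φ : testSpace E) :
    ‖testToL2 E φ‖ ^ 2 ≤ (inner ℝ (schrodingerOp hQ φ) (testToL2 E φ) : ℝ) := by
  rw [form_eq, norm_sq_testToL2]
  have h1 : 0 ≤ ∫ t, ‖deriv φ.1 t‖ ^ 2 := integral_nonneg fun t => by positivity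
  have h2 : ∫ t, ‖φ.1 t‖ ^ 2 ≤ ∫ t, (inner ℝ (Q t (φ.1 t)) (φ.1 t) : ℝ) :=
    integral_mono (integrable_norm_sq_test φ.2.1.continuous φ.2.2) (integrable_form hQ φ)
      fun t => hpos t _
  linarith

theorem denseRange_testToL2 : DenseRange (testToL2 E) := by
  have h := Lp.dense_hasCompactSupport_contDiff (F := E) (μ := (volume : Measure ℝ)) (p := 2)
    (by norm_num)
  refine h.mono ?_
  rintro f ⟨g, hfg, hg1, hg2⟩
  exact ⟨⟨g, hg2, hg1⟩, Lp.ext ((coeFn_testToL2 (⟨g, hg2, hg1⟩ : testSpace E)).trans hfg.symm)⟩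

/-- A vector orthogonal to the range is a square integrable weak solution of `v'' = Qv`, hence zero.
-/
theorem denseRange_schrodingerOp {Q : ℝ → E →L[ℝ] E} (hQ : Continuous Q)
    (hsymm : ∀ t x y, (inner ℝ (Q t x) y : ℝ) = inner ℝ x (Q t y))
    (hpos : ∀ t x, ‖x‖ ^ 2 ≤ (inner ℝ (Q t x) x : ℝ)) : DenseRange (schrodingerOp hQ) := by
  have h : (LinearMap.range (schrodingerOp hQ))ᗮ = ⊥ := by
    rw [Submodule.eq_bot_iff]
    intro v hv
    rw [Submodule.mem_orthogonal'] at hv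
    have h0 := ae_eq_zero_of_weak_solution hQ hsymm
      (fun t x => (sq_nonneg _).trans (hpos t x)) (Lp.memLp v) (by
      intro φ h1 h2
      have := hv _ ⟨⟨φ, h1, h2⟩, rfl⟩
      rw [L2.inner_def] at this
      rw [← this]
      refine integral_congr_ae ?_
      filter_upwards [coeFn_schrodingerOp hQ (⟨φ, h1, h2⟩ : testSpace E)] with t ht
      rw [ht])
    exact (Lp.eq_zero_iff_ae_eq_zero).2 h0
  rw [← Submodule.topologicalClosure_eq_top_iff] at h
  have h2 := Submodule.dense_iff_topologicalClosure_eq_top.2 h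
  rwa [LinearMap.coe_range] at h2

end TestFunctions

/-! ### Uniform estimates and total boundedness of the form ball. -/

section Estimates

universe u

variable {E : Type*} [NormedAddCommGroup E] [InnerProductSpace ℝ E] [CompleteSpace E]

/-- The Hölder-1/2 bound from Cauchy–Schwarz applied to `∫φ'`. -/
theorem norm_sub_le_sqrt (φ : testSpace E) (h : ∫ t, ‖deriv φ.1 t‖ ^ 2 ≤ 1) (s t : ℝ) :
    ‖φ.1 t - φ.1 s‖ ≤ √|t - s| := by
  wlog hst : s ≤ t generalizing s t
  · rw [norm_sub_rev, abs_sub_comm]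
    exact this t s (le_of_not_ge hst)
  rcases hst.eq_or_lt with rfl | hlt
  · simp
  have c1 := φ.2.1.deriv_infty.continuous
  have i1 := integrable_norm_sq_test c1 φ.2.2.deriv
  have hpos : 0 < t - s := sub_pos.2 hlt
  rw [abs_of_pos hpos]
  set a := √(t - s) with ha
  have ha0 : 0 < a := Real.sqrt_pos.2 hpos
  have ha2 : a ^ 2 = t - s := Real.sq_sqrt hpos.le
  have h1 : ∫ x in s..t, deriv φ.1 x = φ.1 t - φ.1 s :=
    intervalIntegral.integral_deriv_eq_sub (fun x _ => φ.2.1.differentiable_infty x)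
      (c1.intervalIntegrable _ _)
  have h2 : ∫ x in s..t, ‖deriv φ.1 x‖ ^ 2 ≤ 1 := by
    rw [intervalIntegral.integral_of_le hst]
    exact (setIntegral_le_integral i1 (Eventually.of_forall fun x => by positivity)).trans h
  -- Cauchy–Schwarz in the form of the weighted inequality `y ≤ (a/2) y² + 1/(2a)`, with the optimal
  -- weight `a = √(t - s)`.
  have h3 : ∫ x in s..t, ‖deriv φ.1 x‖ ≤
      ∫ x in s..t, (a / 2 * ‖deriv φ.1 x‖ ^ 2 + 1 / (2 * a)) := by
    refine intervalIntegral.integral_mono_on hst (c1.norm.intervalIntegrable _ _)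
      (Continuous.intervalIntegrable (by fun_prop) _ _) fun x _ => ?_
    have h4 : a / 2 * ‖deriv φ.1 x‖ ^ 2 + 1 / (2 * a) - ‖deriv φ.1 x‖ =
        (a * ‖deriv φ.1 x‖ - 1) ^ 2 / (2 * a) := by
      field_simp
      ring
    have h5 : 0 ≤ (a * ‖deriv φ.1 x‖ - 1) ^ 2 / (2 * a) := by positivity
    linarith
  rw [intervalIntegral.integral_add (Continuous.intervalIntegrable (by fun_prop) _ _)
    (by simp), intervalIntegral.integral_const_mul, intervalIntegral.integral_const,
    smul_eq_mul, ← ha2] at h3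
  have h6 : a ^ 2 * (1 / (2 * a)) = a / 2 := by
    field_simp
  rw [← h1]
  refine (intervalIntegral.norm_integral_le_integral_norm hst).trans (h3.trans ?_)
  rw [h6]
  nlinarith

/-- On `[t, t + δ]` the function varies by at most `√δ`; if it exceeded `2√δ` at `t` it would exceed
`√δ` on that interval, with mass above `δ²`. -/
theorem norm_le_of_integral_sq_le (φ : testSpace E) (h : ∫ t, ‖deriv φ.1 t‖ ^ 2 ≤ 1) {δ : ℝ}
    (hδ : 0 < δ) (hm : ∫ t, ‖φ.1 t‖ ^ 2 ≤ δ ^ 2) (t : ℝ) : ‖φ.1 t‖ ≤ 2 * √δ := by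
  by_contra! hlt
  have c := φ.2.1.continuous
  have i1 := integrable_norm_sq_test c φ.2.2
  have hs : 0 < √δ := Real.sqrt_pos.2 hδ
  have hs2 : √δ ^ 2 = δ := Real.sq_sqrt hδ.le
  set r := ‖φ.1 t‖ - √δ with hr
  have hr0 : √δ < r := by rw [hr]; linarith
  have h1 : ∫ s in t..(t + δ), ‖φ.1 s‖ ^ 2 ≤ δ ^ 2 := by
    rw [intervalIntegral.integral_of_le (by linarith)]
    exact (setIntegral_le_integral i1 (Eventually.of_forall fun x => by positivity)).trans hm
  have h2 : ∫ _ in t..(t + δ), r ^ 2 ≤ ∫ s in t..(t + δ), ‖φ.1 s‖ ^ 2 := by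
    refine intervalIntegral.integral_mono_on (by linarith) (by simp)
      (Continuous.intervalIntegrable (by fun_prop) _ _) fun s hs' => ?_
    have h3 := norm_sub_le_sqrt φ h s t
    have h4 : √|t - s| ≤ √δ := by
      refine Real.sqrt_le_sqrt ?_
      rw [abs_sub_comm, abs_of_nonneg (by linarith [hs'.1])]
      linarith [hs'.2]
    have h5 := norm_sub_norm_le (φ.1 t) (φ.1 s)
    have h6 : r ≤ ‖φ.1 s‖ := by rw [hr]; linarith
    exact pow_le_pow_left₀ (by linarith) h6 2
  rw [intervalIntegral.integral_const, smul_eq_mul, add_sub_cancel_left] at h2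
  have h7 : δ < r ^ 2 := by nlinarith
  nlinarith

/-- Near infinity `|x|² ≤ k(t) (Q(t) x, x)` for integrable weights `k` of arbitrarily small
integral. -/
def TailCoercive (Q : ℝ → E →L[ℝ] E) : Prop :=
  ∀ ε : ℝ, 0 < ε → ∃ (R : ℝ) (k : ℝ → ℝ), 0 < R ∧ Integrable k ∧ (∀ t, 0 ≤ k t) ∧ ∫ t, k t ≤ ε ∧
    ∀ t x, R ≤ |t| → ‖x‖ ^ 2 ≤ k t * (inner ℝ (Q t x) x : ℝ)

theorem measurableSet_le_abs (R : ℝ) : MeasurableSet {t : ℝ | R ≤ |t|} :=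
  (isClosed_le continuous_const continuous_abs).measurableSet

/-- Off a bounded interval `|φ| ≤ √k √q` with `q = (Qφ, φ)`; the weighted inequality `√k √q ≤ (ε/2)
q + k/(2ε)` with `∫k ≤ ε²` integrates to `ε`. -/
theorem exists_tail_integral_le {Q : ℝ → E →L[ℝ] E} (hQ : Continuous Q)
    (hpos : ∀ t x, ‖x‖ ^ 2 ≤ (inner ℝ (Q t x) x : ℝ)) (htail : TailCoercive Q) {ε : ℝ}
    (hε : 0 < ε) : ∃ R : ℝ, 0 < R ∧ ∀ φ : testSpace E,
      ∫ t, (inner ℝ (Q t (φ.1 t)) (φ.1 t) : ℝ) ≤ 1 → ∫ t in {t | R ≤ |t|}, ‖φ.1 t‖ ≤ ε := by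
  obtain ⟨R, k, hR, hk, hk0, hkε, hkQ⟩ := htail (ε ^ 2) (by positivity)
  refine ⟨R, hR, fun φ hφ => ?_⟩
  have i1 := integrable_form hQ φ
  have i2 : Integrable fun t => ‖φ.1 t‖ :=
    (φ.2.1.continuous.integrable_of_hasCompactSupport φ.2.2).norm
  have hq0 : ∀ t, 0 ≤ (inner ℝ (Q t (φ.1 t)) (φ.1 t) : ℝ) := fun t =>
    (sq_nonneg _).trans (hpos t _)
  have i3 : Integrable fun t => ε / 2 * (inner ℝ (Q t (φ.1 t)) (φ.1 t) : ℝ) + 1 / (2 * ε) * k t :=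
    (i1.const_mul _).add (hk.const_mul _)
  calc ∫ t in {t | R ≤ |t|}, ‖φ.1 t‖
      ≤ ∫ t in {t | R ≤ |t|},
          (ε / 2 * (inner ℝ (Q t (φ.1 t)) (φ.1 t) : ℝ) + 1 / (2 * ε) * k t) := by
        refine setIntegral_mono_on i2.integrableOn i3.integrableOn (measurableSet_le_abs R)
          fun t ht => ?_
        set q := (inner ℝ (Q t (φ.1 t)) (φ.1 t) : ℝ) with hq
        have h1 : ‖φ.1 t‖ ^ 2 ≤ k t * q := hkQ t (φ.1 t) ht
        have h2 : (ε / 2 * q + 1 / (2 * ε) * k t) ^ 2 - k t * q =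
            (ε / 2 * q - 1 / (2 * ε) * k t) ^ 2 := by
          field_simp
          ring
        have h3 : 0 ≤ ε / 2 * q + 1 / (2 * ε) * k t := by
          have := hq0 t
          have := hk0 t
          positivity
        exact le_of_sq_le_sq (by nlinarith [sq_nonneg (ε / 2 * q - 1 / (2 * ε) * k t)]) h3
    _ ≤ ∫ t, (ε / 2 * (inner ℝ (Q t (φ.1 t)) (φ.1 t) : ℝ) + 1 / (2 * ε) * k t) := by
        refine setIntegral_le_integral i3 (Eventually.of_forall fun t => ?_)
        have := hq0 t
        have := hk0 t
        dsimp only [Pi.zero_apply]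
        positivity
    _ = ε / 2 * (∫ t, (inner ℝ (Q t (φ.1 t)) (φ.1 t) : ℝ)) + 1 / (2 * ε) * ∫ t, k t := by
        rw [integral_add (i1.const_mul _) (hk.const_mul _), integral_const_mul,
          integral_const_mul]
    _ ≤ ε / 2 * 1 + 1 / (2 * ε) * ε ^ 2 := by gcongr
    _ = ε := by
        field_simp
        ring

theorem form_le_one {Q : ℝ → E →L[ℝ] E} (hQ : Continuous Q)
    (hpos : ∀ t x, ‖x‖ ^ 2 ≤ (inner ℝ (Q t x) x : ℝ)) {φ : testSpace E}
    (h : (inner ℝ (schrodingerOp hQ φ) (testToL2 E φ) : ℝ) ≤ 1) :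
    ∫ t, ‖deriv φ.1 t‖ ^ 2 ≤ 1 ∧ ∫ t, (inner ℝ (Q t (φ.1 t)) (φ.1 t) : ℝ) ≤ 1 ∧
      ∫ t, ‖φ.1 t‖ ^ 2 ≤ 1 := by
  have h1 : 0 ≤ ∫ t, ‖deriv φ.1 t‖ ^ 2 := integral_nonneg fun t => by positivity
  have h2 : 0 ≤ ∫ t, (inner ℝ (Q t (φ.1 t)) (φ.1 t) : ℝ) :=
    integral_nonneg fun t => (sq_nonneg _).trans (hpos t _)
  have h3 := norm_sq_le_form hQ hpos φ
  rw [norm_sq_testToL2] at h3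
  rw [form_eq] at h h3
  exact ⟨by linarith, by linarith, by linarith⟩

theorem setOf_abs_lt (R : ℝ) : {t : ℝ | R ≤ |t|}ᶜ = Set.Ioo (-R) R := by
  ext t
  simp [abs_lt]

/-- On the form ball, `L²`-smallness implies smallness in `L^∞` and in `L¹`. -/
theorem exists_sup_and_integral_le {Q : ℝ → E →L[ℝ] E} (hQ : Continuous Q)
    (hpos : ∀ t x, ‖x‖ ^ 2 ≤ (inner ℝ (Q t x) x : ℝ)) (htail : TailCoercive Q) {ε : ℝ}
    (hε : 0 < ε) : ∃ δ : ℝ, 0 < δ ∧ ∀ φ : testSpace E,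
      (inner ℝ (schrodingerOp hQ φ) (testToL2 E φ) : ℝ) ≤ 1 → ‖testToL2 E φ‖ ≤ δ →
      (∀ t, ‖φ.1 t‖ ≤ ε) ∧ ∫ t, ‖φ.1 t‖ ≤ ε := by
  obtain ⟨R, hR, htailR⟩ := exists_tail_integral_le hQ hpos htail (half_pos hε)
  obtain ⟨ε', hε'0, hε'1, hε'2⟩ : ∃ ε' : ℝ, 0 < ε' ∧ ε' ≤ ε ∧ 2 * R * ε' ≤ ε / 2 := by
    refine ⟨min ε (ε / (4 * R)), by positivity, min_le_left _ _, ?_⟩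
    have h1 : min ε (ε / (4 * R)) ≤ ε / (4 * R) := min_le_right _ _
    calc 2 * R * min ε (ε / (4 * R)) ≤ 2 * R * (ε / (4 * R)) := by gcongr
      _ = ε / 2 := by
        field_simp
        norm_num
  -- Chosen so that the sup bound `2√δ` equals `ε'`; `ε'` itself is small enough for `(-R, R)` to
  -- contribute at most `ε / 2` to the `L¹` norm.
  refine ⟨(ε' / 2) ^ 2, by positivity, fun φ hφ hm => ?_⟩
  obtain ⟨h1, h2, -⟩ := form_le_one hQ hpos hφ
  have h3 : ∀ t, ‖φ.1 t‖ ≤ ε' := by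
    intro t
    have hm' : ∫ t, ‖φ.1 t‖ ^ 2 ≤ ((ε' / 2) ^ 2) ^ 2 := by
      rw [← norm_sq_testToL2]
      exact pow_le_pow_left₀ (norm_nonneg _) hm 2
    have := norm_le_of_integral_sq_le φ h1 (by positivity) hm' t
    rw [Real.sqrt_sq (by positivity)] at this
    linarith
  refine ⟨fun t => (h3 t).trans hε'1, ?_⟩
  have i2 : Integrable fun t => ‖φ.1 t‖ :=
    (φ.2.1.continuous.integrable_of_hasCompactSupport φ.2.2).norm
  rw [← integral_add_compl (measurableSet_le_abs R) i2, setOf_abs_lt]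
  have h4 : ∫ t in Set.Ioo (-R) R, ‖φ.1 t‖ ≤ 2 * R * ε' := by
    have h5 := norm_setIntegral_le_of_norm_le_const (μ := volume) (s := Set.Ioo (-R) R)
      (f := fun t => ‖φ.1 t‖) (C := ε') (by simp) fun t _ => by simpa using h3 t
    rw [Measure.real, Real.volume_Ioo, ENNReal.toReal_ofReal (by linarith)] at h5
    refine (Real.le_norm_self _).trans (h5.trans (le_of_eq ?_))
    ring
  have := htailR φ h2
  linarith

/-- A set is totally bounded if each of its points is determined, up to a small error, by data in
a totally bounded set. -/
theorem totallyBounded_of_modulus {α : Type u} [PseudoMetricSpace α] {s : Set α}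
    (h : ∀ ε > 0, ∃ (β : Type u) (_ : PseudoMetricSpace β) (f : s → β) (δ : ℝ), 0 < δ ∧ TotallyBounded (Set.range f) ∧
      ∀ x y, dist (f x) (f y) < δ → dist x y < ε) : TotallyBounded s := by
  refine Metric.totallyBounded_of_finite_discretization fun ε hε => ?_
  obtain ⟨β, _, f, δ, hδ, hf, hfδ⟩ := h ε hε
  obtain ⟨t, ht, hcov⟩ := Metric.totallyBounded_iff.1 hf (δ / 2) (half_pos hδ)
  have hex : ∀ x : s, ∃ y : t, dist (f x) y < δ / 2 := by
    intro x
    obtain ⟨y, hy, hxy⟩ := Set.mem_iUnion₂.1 (hcov ⟨x, rfl⟩)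
    exact ⟨⟨y, hy⟩, hxy⟩
  choose F hF using hex
  refine ⟨t, ht.fintype, F, fun x y hxy => hfδ x y ?_⟩
  have h1 := hF x
  have h2 := hF y
  rw [← hxy] at h2
  have h3 := dist_triangle_right (f x) (f y) (F x)
  linarith

/-- The parallelogram law gives the difference form value at most `4`, which the factor `1/2` brings
back to `1`. -/
theorem form_half_sub_le {Q : ℝ → E →L[ℝ] E} (hQ : Continuous Q)
    (hpos : ∀ t x, ‖x‖ ^ 2 ≤ (inner ℝ (Q t x) x : ℝ)) {φ ψ : testSpace E}
    (hφ : (inner ℝ (schrodingerOp hQ φ) (testToL2 E φ) : ℝ) ≤ 1)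
    (hψ : (inner ℝ (schrodingerOp hQ ψ) (testToL2 E ψ) : ℝ) ≤ 1) :
    (inner ℝ (schrodingerOp hQ ((1 / 2 : ℝ) • (φ - ψ)))
      (testToL2 E ((1 / 2 : ℝ) • (φ - ψ))) : ℝ) ≤ 1 := by
  have h := (sq_nonneg _).trans (norm_sq_le_form hQ hpos (φ + ψ))
  simp only [map_smul, map_sub, map_add, inner_smul_left, inner_smul_right, inner_add_left,
    inner_add_right, inner_sub_left, inner_sub_right, conj_trivial] at h ⊢
  linarith

/-- A direct Arzelà–Ascoli argument: by equicontinuity, values on a finite grid control a function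
on `(-R, R)`, and outside the sup bound times the small `L¹` tail controls the square integral. -/
theorem totallyBounded_form_ball [FiniteDimensional ℝ E] {Q : ℝ → E →L[ℝ] E} (hQ : Continuous Q)
    (hpos : ∀ t x, ‖x‖ ^ 2 ≤ (inner ℝ (Q t x) x : ℝ)) (htail : TailCoercive Q) :
    TotallyBounded
      (testToL2 E '' {φ | (inner ℝ (schrodingerOp hQ φ) (testToL2 E φ) : ℝ) ≤ 1}) := by
  have hsup : ∀ φ : testSpace E, (inner ℝ (schrodingerOp hQ φ) (testToL2 E φ) : ℝ) ≤ 1 →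
      ∀ t, ‖φ.1 t‖ ≤ 2 := by
    intro φ hφ t
    obtain ⟨h1, -, h3⟩ := form_le_one hQ hpos hφ
    have := norm_le_of_integral_sq_le φ h1 one_pos (by simpa using h3) t
    simpa using this
  choose g hg1 hg2 using fun x : testToL2 E ''
    {φ | (inner ℝ (schrodingerOp hQ φ) (testToL2 E φ) : ℝ) ≤ 1} => x.2
  simp only [Set.mem_ofPred_eq] at hg1
  have hgrid : ∀ ε > 0, ∃ (n : ℕ) (x : Fin n → ℝ) (δ : ℝ), 0 < δ ∧ ∀ χ : testSpace E,
      (inner ℝ (schrodingerOp hQ χ) (testToL2 E χ) : ℝ) ≤ 1 → (∀ i, ‖χ.1 (x i)‖ ≤ δ) →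
        ‖testToL2 E χ‖ < ε := by
    intro ε hε
    obtain ⟨R, hR, htailR⟩ := exists_tail_integral_le hQ hpos htail
      (by positivity : 0 < ε ^ 2 / 8)
    obtain ⟨δ, hδ, hδ1, hδ2⟩ : ∃ δ : ℝ, 0 < δ ∧ δ ≤ 1 ∧ 8 * R * δ ≤ ε ^ 2 / 4 := by
      refine ⟨min 1 (ε ^ 2 / (32 * R)), by positivity, min_le_left _ _, ?_⟩
      have h1 : min 1 (ε ^ 2 / (32 * R)) ≤ ε ^ 2 / (32 * R) := min_le_right _ _
      calc 8 * R * min 1 (ε ^ 2 / (32 * R)) ≤ 8 * R * (ε ^ 2 / (32 * R)) := by gcongr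
        _ = ε ^ 2 / 4 := by
          field_simp
          norm_num
    -- Mesh `δ²`, because the Hölder bound over one mesh is then `δ`; the extra point covers every
    -- floor index occurring on `(-R, R)`.
    refine ⟨⌊2 * R / δ ^ 2⌋₊ + 1, fun k => -R + k * δ ^ 2, δ, hδ, fun χ hχ hx => ?_⟩
    obtain ⟨h1, h2, -⟩ := form_le_one hQ hpos hχ
    have h3 : ∀ t ∈ Set.Ioo (-R) R, ‖χ.1 t‖ ≤ 2 * δ := by
      intro t ht
      have h4 : 0 ≤ (t + R) / δ ^ 2 := div_nonneg (by linarith [ht.1]) (by positivity)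
      set k := ⌊(t + R) / δ ^ 2⌋₊ with hk
      have h5 : (k : ℝ) * δ ^ 2 ≤ t + R := (le_div_iff₀ (by positivity)).1 (Nat.floor_le h4)
      have h6 : t + R < (k + 1) * δ ^ 2 :=
        (div_lt_iff₀ (by positivity)).1 (Nat.lt_floor_add_one ((t + R) / δ ^ 2))
      have h7 : k < ⌊2 * R / δ ^ 2⌋₊ + 1 := by
        refine Nat.lt_succ_of_le (Nat.floor_le_floor ?_)
        gcongr
        linarith [ht.2]
      have h8 := hx ⟨k, h7⟩
      dsimp only at h8
      have h9 := norm_sub_le_sqrt χ h1 (-R + k * δ ^ 2) t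
      have h10 : √|t - (-R + k * δ ^ 2)| ≤ δ := by
        rw [Real.sqrt_le_left hδ.le, abs_of_nonneg (by linarith)]
        linarith
      have h11 := norm_sub_norm_le (χ.1 t) (χ.1 (-R + k * δ ^ 2))
      linarith
    have i2 := integrable_norm_sq_test χ.2.1.continuous χ.2.2
    have i3 : Integrable fun t => ‖χ.1 t‖ :=
      (χ.2.1.continuous.integrable_of_hasCompactSupport χ.2.2).norm
    refine lt_of_pow_lt_pow_left₀ 2 hε.le ?_
    rw [norm_sq_testToL2, ← integral_add_compl (measurableSet_le_abs R) i2, setOf_abs_lt]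
    have h12 : ∫ t in Set.Ioo (-R) R, ‖χ.1 t‖ ^ 2 ≤ 8 * R * δ := by
      have h5 := norm_setIntegral_le_of_norm_le_const (μ := volume) (s := Set.Ioo (-R) R)
        (f := fun t => ‖χ.1 t‖ ^ 2) (C := (2 * δ) ^ 2) (by simp) fun t ht => by
          rw [Real.norm_of_nonneg (by positivity)]
          exact pow_le_pow_left₀ (norm_nonneg _) (h3 t ht) 2
      rw [Measure.real, Real.volume_Ioo, ENNReal.toReal_ofReal (by linarith)] at h5
      refine (Real.le_norm_self _).trans (h5.trans ?_)
      have : δ ^ 2 ≤ δ := by nlinarith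
      nlinarith
    have h13 : ∫ t in {t | R ≤ |t|}, ‖χ.1 t‖ ^ 2 ≤ 2 * (ε ^ 2 / 8) := by
      refine le_trans ?_ (mul_le_mul_of_nonneg_left (htailR χ h2) zero_le_two)
      rw [← integral_const_mul]
      refine setIntegral_mono i2.integrableOn (i3.const_mul 2).integrableOn fun t => ?_
      have := hsup χ hχ t
      have := norm_nonneg (χ.1 t)
      dsimp only
      nlinarith
    have : 0 < ε ^ 2 := by positivity
    linarith
  refine totallyBounded_of_modulus fun ε hε => ?_
  obtain ⟨n, x, δ, hδ, H⟩ := hgrid (ε / 2) (half_pos hε)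
  refine ⟨Fin n → E, inferInstance, fun y i => (g y).1 (x i), δ, hδ, ?_, fun y z hyz => ?_⟩
  · refine (isCompact_closedBall (0 : Fin n → E) 2).totallyBounded.subset ?_
    rintro _ ⟨y, rfl⟩
    rw [mem_closedBall_zero_iff, pi_norm_le_iff_of_nonneg zero_le_two]
    exact fun i => hsup _ (hg1 y) _
  -- The half difference stays in the form ball, so the grid estimate applies to it; this is why it
  -- was taken with `ε / 2`.
  · have h1 := H ((1 / 2 : ℝ) • (g y - g z)) (form_half_sub_le hQ hpos (hg1 y) (hg1 z)) fun i => by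
      have h2 := (dist_le_pi_dist (fun i => (g y).1 (x i)) (fun i => (g z).1 (x i)) i).trans hyz.le
      rw [dist_eq_norm] at h2
      simp only [Submodule.coe_smul, Submodule.coe_sub, Pi.smul_apply, Pi.sub_apply, norm_smul]
      rw [Real.norm_of_nonneg (by norm_num)]
      linarith [norm_nonneg ((g y).1 (x i) - (g z).1 (x i))]
    rw [map_smul, map_sub, hg2, hg2, norm_smul, Real.norm_of_nonneg (by norm_num)] at h1
    rw [Subtype.dist_eq, dist_eq_norm]
    linarith

end Estimates

/-! ### From `L²` to `L^p`: boundedness and compactness. -/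

section Embedding

universe u

variable {E : Type u} [NormedAddCommGroup E] [InnerProductSpace ℝ E] [CompleteSpace E]

/-- For finite `p`, interpolation between the endpoints: `|f|^p ≤ a^(p-1) |f|`. -/
theorem eLpNorm_le_of_sup_of_integral {f : ℝ → E} (hf : Integrable f) {a : ℝ}
    (h1 : ∀ t, ‖f t‖ ≤ a) (h2 : ∫ t, ‖f t‖ ≤ a) {p : ℝ≥0∞} (hp : 1 ≤ p) :
    eLpNorm f p volume ≤ ENNReal.ofReal a := by
  rcases eq_or_ne p ⊤ with rfl | hpt
  · rw [eLpNorm_exponent_top]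
    exact eLpNormEssSup_le_of_ae_bound (Eventually.of_forall h1)
  have hp0 : p ≠ 0 := (one_pos.trans_le hp).ne'
  have hp1 : 1 ≤ p.toReal := by
    rw [← ENNReal.toReal_one]
    exact ENNReal.toReal_mono hpt hp
  have hp' : 0 < p.toReal := one_pos.trans_le hp1
  rw [eLpNorm_eq_lintegral_rpow_enorm_toReal hp0 hpt, one_div, ENNReal.rpow_inv_le_iff hp']
  have h3 : ∀ t, ‖f t‖ₑ ≤ ENNReal.ofReal a := fun t => by
    rw [← ofReal_norm]
    exact ENNReal.ofReal_le_ofReal (h1 t)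
  have h4 : ∫⁻ t, ‖f t‖ₑ ≤ ENNReal.ofReal a := by
    rw [← ofReal_integral_norm_eq_lintegral_enorm hf]
    exact ENNReal.ofReal_le_ofReal h2
  have h5 : ∀ x : ℝ≥0∞, x ^ p.toReal = x ^ (p.toReal - 1) * x := fun x => by
    conv_rhs => rw [← ENNReal.rpow_one x]
    rw [← ENNReal.rpow_mul, one_mul, ← ENNReal.rpow_add_of_nonneg _ _ (by linarith) zero_le_one,
      sub_add_cancel]
  calc ∫⁻ t, ‖f t‖ₑ ^ p.toReal ≤ ∫⁻ t, ENNReal.ofReal a ^ (p.toReal - 1) * ‖f t‖ₑ := by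
        refine lintegral_mono fun t => ?_
        rw [h5]
        gcongr
        exact h3 t
    _ = ENNReal.ofReal a ^ (p.toReal - 1) * ∫⁻ t, ‖f t‖ₑ := by
        refine lintegral_const_mul' _ _ (ENNReal.rpow_ne_top_of_nonneg (by linarith) ?_)
        exact ENNReal.ofReal_ne_top
    _ ≤ ENNReal.ofReal a ^ (p.toReal - 1) * ENNReal.ofReal a := by gcongr
    _ = ENNReal.ofReal a ^ p.toReal := (h5 _).symm

/-- On the closed form ball, `L²`-smallness implies `L^p`-smallness. -/
theorem exists_eLpNorm_le_of_mem_closure {Q : ℝ → E →L[ℝ] E} (hQ : Continuous Q)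
    (hpos : ∀ t x, ‖x‖ ^ 2 ≤ (inner ℝ (Q t x) x : ℝ)) (htail : TailCoercive Q) {p : ℝ≥0∞}
    (hp : 1 ≤ p) {ε : ℝ} (hε : 0 < ε) : ∃ δ : ℝ, 0 < δ ∧ ∀ u ∈ closure
      (testToL2 E '' {φ | (inner ℝ (schrodingerOp hQ φ) (testToL2 E φ) : ℝ) ≤ 1}),
      ‖u‖ < δ → eLpNorm u p volume ≤ ENNReal.ofReal ε := by
  obtain ⟨δ, hδ, H⟩ := exists_sup_and_integral_le hQ hpos htail hε
  refine ⟨δ, hδ, fun u hu huδ => ?_⟩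
  obtain ⟨x, hx, hlim⟩ := mem_closure_iff_seq_limit.1 hu
  -- `L²` limits are limits in measure, along which the `L^p` norm is lower semicontinuous.
  refine eLpNorm_le_of_tendstoInMeasure ?_ (tendstoInMeasure_of_tendsto_Lp hlim)
    fun n => Lp.aestronglyMeasurable _
  filter_upwards [hlim.norm.eventually_lt_const huδ] with n hn
  obtain ⟨φ, hφ, hφx⟩ := hx n
  rw [← hφx] at hn ⊢
  obtain ⟨h1, h2⟩ := H φ hφ hn.le
  rw [eLpNorm_congr_ae (coeFn_testToL2 φ)]
  exact eLpNorm_le_of_sup_of_integral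
    (φ.2.1.continuous.integrable_of_hasCompactSupport φ.2.2) h1 h2 hp

/-- A quadratic functional `q` on a subspace of `L²` whose unit ball lies in a totally bounded set
on which `L²`-smallness implies `L^p`-smallness gives a compact embedding into `L^p`. -/
theorem exists_compact_embedding {p : ℝ≥0∞} [Fact (1 ≤ p)]
    {D : Submodule ℝ (Lp E 2 (volume : Measure ℝ))} {q : D → ℝ}
    (hsmul : ∀ (c : ℝ) u, q (c • u) = c ^ 2 * q u)
    (hsub : ∀ u v, q (u - v) ≤ 2 * (q u + q v)) {W : Set (Lp E 2 (volume : Measure ℝ))}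
    (hW : TotallyBounded W) (hqW : ∀ u, q u < 1 → (u : Lp E 2 (volume : Measure ℝ)) ∈ closure W)
    (hWp : ∀ ε > 0, ∃ δ : ℝ, 0 < δ ∧ ∀ u ∈ closure W, ‖u‖ < δ →
      eLpNorm u p volume ≤ ENNReal.ofReal ε) :
    ∃ ι : D →ₗ[ℝ] Lp E p (volume : Measure ℝ),
      (∀ u : D, (ι u : ℝ → E) =ᵐ[volume] ((u : Lp E 2 (volume : Measure ℝ)) : ℝ → E)) ∧
      (∃ C : ℝ, 0 < C ∧ ∀ u : D, ‖ι u‖ ≤ C * √(q u)) ∧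
      ∀ r : ℝ, IsCompact (closure (ι '' {u : D | q u ≤ r})) := by
  have hsm : ∀ (c : ℝ) (u : D), eLpNorm ((c • u : D) : Lp E 2 (volume : Measure ℝ)) p volume =
      ‖c‖ₑ * eLpNorm (u : Lp E 2 (volume : Measure ℝ)) p volume := by
    intro c u
    rw [← eLpNorm_const_smul]
    exact eLpNorm_congr_ae (Lp.coeFn_smul c (u : Lp E 2 (volume : Measure ℝ)))
  obtain ⟨M, hM0, hM⟩ := hW.closure.isBounded.exists_pos_norm_le
  obtain ⟨δ, hδ, hδp⟩ := hWp 1 one_pos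
  -- Scaling by `c` makes every vector of the open unit ball of `q` shorter than `δ` in `L²`, since
  -- `M` bounds the closure of `W`.
  obtain ⟨c, hc0, hc1, hcM⟩ : ∃ c : ℝ, 0 < c ∧ c ≤ 1 ∧ c * M < δ := by
    refine ⟨min 1 (δ / (2 * M)), by positivity, min_le_left _ _, ?_⟩
    have h1 : min 1 (δ / (2 * M)) ≤ δ / (2 * M) := min_le_right _ _
    calc min 1 (δ / (2 * M)) * M ≤ δ / (2 * M) * M := by gcongr
      _ = δ / 2 := by field_simp
      _ < δ := half_lt_self hδ
  have hunit : ∀ u : D, q u < 1 →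
      eLpNorm ((c • u : D) : Lp E 2 (volume : Measure ℝ)) p volume ≤ ENNReal.ofReal 1 := by
    intro u hu
    refine hδp _ (hqW _ ?_) ?_
    · rw [hsmul]
      rcases le_total (q u) 0 with h0 | h0
      · nlinarith [sq_nonneg c]
      · have : c ^ 2 ≤ 1 := by nlinarith
        nlinarith
    · rw [Submodule.coe_smul, norm_smul, Real.norm_of_nonneg hc0.le]
      exact (mul_le_mul_of_nonneg_left (hM _ (hqW u hu)) hc0.le).trans_lt hcM
  have hscale : ∀ (u : D) (s : ℝ), √(q u) < s → q (s⁻¹ • u) < 1 := by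
    intro u s hs
    have hs0 : 0 < s := (Real.sqrt_nonneg _).trans_lt hs
    rw [hsmul, inv_pow, inv_mul_lt_iff₀ (by positivity), mul_one]
    exact (Real.sqrt_lt' hs0).1 hs
  have hmem : ∀ u : D, MemLp (u : Lp E 2 (volume : Measure ℝ)) p := by
    intro u
    refine ⟨Lp.aestronglyMeasurable _, ?_⟩
    set s := √(q u) + 1 with hs
    have hs0 : 0 < s := by positivity
    have h1 := hunit (s⁻¹ • u) (hscale u s (by linarith))
    rw [hsm, hsm] at h1
    have h2 : ‖c‖ₑ ≠ 0 := by simpa using hc0.ne'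
    have h3 : ‖s⁻¹‖ₑ ≠ 0 := by simpa using hs0.ne'
    by_contra h4
    rw [not_lt, top_le_iff] at h4
    rw [h4, ENNReal.mul_top h3, ENNReal.mul_top h2, top_le_iff] at h1
    exact ENNReal.ofReal_ne_top h1
  let ι : D →ₗ[ℝ] Lp E p (volume : Measure ℝ) :=
    { toFun := fun u => (hmem u).toLp _
      map_add' := fun u v => by
        rw [← MemLp.toLp_add]
        exact MemLp.toLp_congr _ _ (Lp.coeFn_add _ _)
      map_smul' := fun a u => by
        rw [RingHom.id_apply, ← MemLp.toLp_const_smul]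
        exact MemLp.toLp_congr _ _ (Lp.coeFn_smul _ _) }
  have hι : ∀ u : D, ‖ι u‖ = (eLpNorm (u : Lp E 2 (volume : Measure ℝ)) p volume).toReal :=
    fun u => Lp.norm_toLp _ (hmem u)
  have hιle : ∀ (u : D) (a : ℝ), 0 ≤ a →
      eLpNorm (u : Lp E 2 (volume : Measure ℝ)) p volume ≤ ENNReal.ofReal a → ‖ι u‖ ≤ a := by
    intro u a ha h
    rw [hι]
    exact ENNReal.toReal_le_of_le_ofReal ha h
  refine ⟨ι, fun u => (hmem u).coeFn_toLp, ⟨c⁻¹, by positivity, fun u => ?_⟩, fun r => ?_⟩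
  -- The unit ball is open, so the normalising factor must strictly exceed `√(q u)`; the excess `c
  -- η` costs only `η`.
  · refine le_of_forall_pos_le_add fun η hη => ?_
    set s := √(q u) + c * η with hs
    have hs0 : 0 < s := by positivity
    have h1 := hιle _ 1 zero_le_one
      (hunit (s⁻¹ • u) (hscale u s (by linarith [mul_pos hc0 hη])))
    rw [map_smul, map_smul, norm_smul, norm_smul, Real.norm_of_nonneg hc0.le,
      Real.norm_of_nonneg (by positivity), ← mul_assoc, ← div_eq_mul_inv, div_mul_eq_mul_div,
      div_le_one hs0] at h1
    calc ‖ι u‖ = c⁻¹ * (c * ‖ι u‖) := by field_simp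
      _ ≤ c⁻¹ * s := by gcongr
      _ = c⁻¹ * √(q u) + η := by
        rw [hs]
        field_simp
  · refine TotallyBounded.isCompact_of_isClosed ?_ isClosed_closure
    refine TotallyBounded.closure ?_
    -- Differences of vectors with `q ≤ r` have `q ≤ 4|r|`; scaling by `a` brings them into the open
    -- unit ball.
    obtain ⟨a, ha0, ha⟩ : ∃ a : ℝ, 0 < a ∧ ∀ x, x ≤ 4 * |r| → a ^ 2 * x < 1 := by
      refine ⟨(2 * (|r| + 1))⁻¹, by positivity, fun x hx => ?_⟩
      rw [inv_pow, inv_mul_lt_iff₀ (by positivity), mul_one]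
      nlinarith [abs_nonneg r]
    refine totallyBounded_of_modulus fun ε hε => ?_
    obtain ⟨δ, hδ, hδp⟩ := hWp (a * (ε / 2)) (by positivity)
    choose g hg1 hg2 using fun y : ι '' {u : D | q u ≤ r} => y.2
    simp only [Set.mem_ofPred_eq] at hg1
    refine ⟨Lp E 2 (volume : Measure ℝ), inferInstance, fun y => ((a • g y : D) : Lp E 2 volume),
      δ, hδ, hW.closure.subset ?_, fun y z hyz => ?_⟩
    · rintro _ ⟨y, rfl⟩
      refine hqW _ ?_
      rw [hsmul]
      refine ha _ ?_
      have := hg1 y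
      linarith [le_abs_self r, abs_nonneg r]
    · have h1 : ‖ι (a • (g y - g z))‖ ≤ a * (ε / 2) := by
        refine hιle _ _ (by positivity) (hδp _ (hqW _ ?_) ?_)
        · rw [hsmul]
          refine ha _ ?_
          have h2 := hsub (g y) (g z)
          have h3 := hg1 y
          have h4 := hg1 z
          linarith [le_abs_self r]
        · rw [smul_sub, Submodule.coe_sub, ← dist_eq_norm]
          exact hyz
      rw [map_smul, map_sub, hg2, hg2, norm_smul, Real.norm_of_nonneg ha0.le] at h1
      have h2 := le_of_mul_le_mul_left h1 ha0
      rw [Subtype.dist_eq, dist_eq_norm]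
      linarith

end Embedding

/-! ### The coercivity condition yields small integrable weights. -/

section Coercivity

variable {N : ℕ}

/-- A primitive is `-(ln t)^(1-α) / (M (α - 1))`; it tends to `0` at infinity precisely because `α >
1`. -/
theorem integral_inv_mul_log_rpow {α M : ℝ} (hα : 1 < α) (hM : 0 < M) {R : ℝ} (hR : 1 < R) :
    IntegrableOn (fun t : ℝ => (M * (t * Real.log t ^ α))⁻¹) (Set.Ioi R) ∧
      ∫ t in Set.Ioi R, (M * (t * Real.log t ^ α))⁻¹ =
        Real.log R ^ (-(α - 1)) / (M * (α - 1)) := by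
  have hα1 : 0 < α - 1 := by linarith
  have hderiv : ∀ t ∈ Set.Ici R, HasDerivAt
      (fun t : ℝ => -(Real.log t ^ (-(α - 1)) / (M * (α - 1)))) (M * (t * Real.log t ^ α))⁻¹ t := by
    intro t ht
    have ht1 : 1 < t := hR.trans_le ht
    have hlog : 0 < Real.log t := Real.log_pos ht1
    have h1 := (((Real.hasDerivAt_log (by linarith : t ≠ 0)).rpow_const (p := -(α - 1))
      (Or.inl hlog.ne')).div_const (M * (α - 1))).neg
    refine h1.congr_deriv ?_
    rw [show -(α - 1) - 1 = -α by ring, Real.rpow_neg hlog.le]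
    have h2 : 0 < Real.log t ^ α := Real.rpow_pos_of_pos hlog α
    field_simp
  have hnonneg : ∀ t ∈ Set.Ioi R, 0 ≤ (M * (t * Real.log t ^ α))⁻¹ := by
    intro t ht
    have ht1 : 1 < t := hR.trans ht
    have : 0 ≤ Real.log t ^ α := Real.rpow_nonneg (Real.log_pos ht1).le α
    positivity
  have hlim : Tendsto (fun t : ℝ => -(Real.log t ^ (-(α - 1)) / (M * (α - 1)))) atTop (𝓝 0) := by
    have h1 := ((tendsto_rpow_neg_atTop hα1).comp Real.tendsto_log_atTop).div_const (M * (α - 1))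
    simpa using h1.neg
  refine ⟨integrableOn_Ioi_deriv_of_nonneg' hderiv hnonneg hlim, ?_⟩
  rw [integral_Ioi_of_hasDerivAt_of_nonneg' hderiv hnonneg hlim]
  ring

/-- The potential `L(t) + c`. -/
noncomputable def shiftedPotential (L : ℝ → Matrix (Fin N) (Fin N) ℝ) (c : ℝ) (t : ℝ) :
    EuclideanSpace ℝ (Fin N) →L[ℝ] EuclideanSpace ℝ (Fin N) :=
  Matrix.toEuclideanCLM (𝕜 := ℝ) (L t) + c • ContinuousLinearMap.id ℝ _

theorem shiftedPotential_apply (L : ℝ → Matrix (Fin N) (Fin N) ℝ) (c t : ℝ)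
    (x : EuclideanSpace ℝ (Fin N)) :
    shiftedPotential L c t x = Matrix.toEuclideanCLM (𝕜 := ℝ) (L t) x + c • x := rfl

theorem inner_shiftedPotential (L : ℝ → Matrix (Fin N) (Fin N) ℝ) (c t : ℝ)
    (x : EuclideanSpace ℝ (Fin N)) :
    (inner ℝ (shiftedPotential L c t x) x : ℝ) = quadForm (L t) x + c * ‖x‖ ^ 2 := by
  rw [shiftedPotential_apply, inner_add_left, inner_smul_left, real_inner_self_eq_norm_sq]
  rfl

theorem continuous_shiftedPotential {L : ℝ → Matrix (Fin N) (Fin N) ℝ} (hL : Continuous L) (c : ℝ) :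
    Continuous (shiftedPotential L c) := by
  have h : Continuous fun A : Matrix (Fin N) (Fin N) ℝ => Matrix.toEuclideanCLM (𝕜 := ℝ) A :=
    LinearMap.continuous_of_finiteDimensional
      (Matrix.toEuclideanCLM (n := Fin N) (𝕜 := ℝ)).toAlgEquiv.toLinearMap
  exact (h.comp hL).add continuous_const

theorem shiftedPotential_symm {L : ℝ → Matrix (Fin N) (Fin N) ℝ} (hL : ∀ t, (L t).IsSymm)
    (c t : ℝ) (x y : EuclideanSpace ℝ (Fin N)) :
    (inner ℝ (shiftedPotential L c t x) y : ℝ) = inner ℝ x (shiftedPotential L c t y) := by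
  have h : star (L t) = L t := by
    rw [Matrix.star_eq_conjTranspose, Matrix.conjTranspose_eq_transpose_of_trivial, hL t]
  have h1 : ContinuousLinearMap.adjoint (Matrix.toEuclideanCLM (𝕜 := ℝ) (L t)) =
      Matrix.toEuclideanCLM (𝕜 := ℝ) (L t) := by
    rw [← ContinuousLinearMap.star_eq_adjoint, ← map_star, h]
  rw [shiftedPotential_apply, shiftedPotential_apply, inner_add_left, inner_add_right,
    inner_smul_left, inner_smul_right, ← ContinuousLinearMap.adjoint_inner_left, h1]
  rfl

theorem quadForm_smul (A : Matrix (Fin N) (Fin N) ℝ) (a : ℝ) (x : EuclideanSpace ℝ (Fin N)) :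
    quadForm A (a • x) = a ^ 2 * quadForm A x := by
  rw [quadForm, quadForm, map_smul, inner_smul_left, inner_smul_right, conj_trivial]
  ring

theorem mul_norm_sq_le_quadForm {A : Matrix (Fin N) (Fin N) ℝ} {m : ℝ}
    (h : ∀ x : EuclideanSpace ℝ (Fin N), ‖x‖ = 1 → m ≤ quadForm A x)
    (x : EuclideanSpace ℝ (Fin N)) : m * ‖x‖ ^ 2 ≤ quadForm A x := by
  rcases eq_or_ne x 0 with rfl | hx
  · simp [quadForm]
  have hx' : 0 < ‖x‖ := norm_pos_iff.2 hx
  have h1 := h (‖x‖⁻¹ • x) (norm_smul_inv_norm hx)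
  rw [quadForm_smul, inv_pow, inv_mul_eq_div, le_div_iff₀ (by positivity)] at h1
  exact h1

/-- The weight is `1` on the bad set, where the shifted lower bound suffices, plus `1 / (M |t| ln^α
|t|)`, which (L1) justifies elsewhere. Both pieces have small integral far out. -/
theorem CoercivityCondition.tailCoercive {L : ℝ → Matrix (Fin N) (Fin N) ℝ}
    (hL : CoercivityCondition L) {c : ℝ} (hc : 0 ≤ c)
    (hpos : ∀ t x, ‖x‖ ^ 2 ≤ (inner ℝ (shiftedPotential L c t x) x : ℝ)) :
    TailCoercive (shiftedPotential L c) := by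
  obtain ⟨α, M, hα, hM, hlim⟩ := hL
  intro ε hε
  have hα1 : 0 < α - 1 := by linarith
  have hlog : Tendsto (fun t : ℝ => Real.log t ^ (-(α - 1)) / (M * (α - 1))) atTop (𝓝 0) := by
    have h1 := ((tendsto_rpow_neg_atTop hα1).comp Real.tendsto_log_atTop).div_const (M * (α - 1))
    simpa using h1
  obtain ⟨R, hR1, hR2, hR3⟩ := ((eventually_gt_atTop 1).and
    ((hlog.eventually_le_const (by positivity : (0 : ℝ) < ε / 4)).and
    ((tendsto_atTop_add_const_right atTop (1 : ℝ) tendsto_id).eventually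
      (hlim.eventually_le_const (by positivity : 0 < ENNReal.ofReal (ε / 2)))))).exists
  simp only [id_eq] at hR3
  set Z : Set ℝ := {t : ℝ | R + 1 ≤ |t| ∧ ∃ x : EuclideanSpace ℝ (Fin N), ‖x‖ = 1 ∧
    quadForm (L t) x / (|t| * Real.log |t| ^ α) ≤ M} with hZ
  obtain ⟨hi, hv⟩ := integral_inv_mul_log_rpow hα hM hR1
  set w : ℝ → ℝ := (Set.Ioi R).indicator fun t => (M * (t * Real.log t ^ α))⁻¹ with hw
  have hwi : Integrable w := hi.integrable_indicator measurableSet_Ioi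
  have hwv : ∫ t, w t ≤ ε / 4 := by
    rw [hw, integral_indicator measurableSet_Ioi, hv]
    exact hR2
  have hw0 : ∀ t, 0 ≤ w t := by
    refine Set.indicator_nonneg fun t ht => ?_
    have ht1 : 1 < t := hR1.trans ht
    have : 0 ≤ Real.log t ^ α := Real.rpow_nonneg (Real.log_pos ht1).le α
    positivity
  -- A measurable hull of the bad set has the same measure and avoids proving the set itself
  -- measurable.
  have hZm := measurableSet_toMeasurable volume Z
  have hZle : volume (toMeasurable volume Z) ≤ ENNReal.ofReal (ε / 2) := by
    rw [measure_toMeasurable]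
    exact hR3
  have hzi : Integrable ((toMeasurable volume Z).indicator fun _ => (1 : ℝ)) :=
    (integrableOn_const (hZle.trans_lt ENNReal.ofReal_lt_top).ne).integrable_indicator hZm
  have hz0 : ∀ t, 0 ≤ (toMeasurable volume Z).indicator (fun _ => (1 : ℝ)) t :=
    Set.indicator_nonneg fun t _ => zero_le_one
  have hzv : ∫ t, (toMeasurable volume Z).indicator (fun _ => (1 : ℝ)) t ≤ ε / 2 := by
    rw [integral_indicator hZm, setIntegral_const, smul_eq_mul, mul_one]
    exact ENNReal.toReal_le_of_le_ofReal (by positivity) hZle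
  -- The radius `R + 1` ensures `|t| > R` strictly, so one of the two reflected copies of `w` is
  -- active; the integrals add up to `ε/2 + ε/4 + ε/4`.
  refine ⟨R + 1, fun t => (toMeasurable volume Z).indicator (fun _ => (1 : ℝ)) t + (w t + w (-t)),
    by linarith, hzi.add (hwi.add hwi.comp_neg), fun t => ?_, ?_, fun t x ht => ?_⟩
  · have := hz0 t
    have := hw0 t
    have := hw0 (-t)
    positivity
  · dsimp only
    rw [integral_add hzi (hwi.fun_add hwi.comp_neg), integral_add hwi hwi.comp_neg,
      integral_neg_eq_self w]
    linarith
  · have hq0 : 0 ≤ (inner ℝ (shiftedPotential L c t x) x : ℝ) := (sq_nonneg _).trans (hpos t x)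
    by_cases hz : t ∈ Z
    · refine (hpos t x).trans (le_mul_of_one_le_left hq0 ?_)
      dsimp only
      rw [Set.indicator_of_mem (subset_toMeasurable _ _ hz)]
      linarith [hw0 t, hw0 (-t)]
    · have ht1 : 1 < |t| := by linarith
      have hlog0 : 0 < Real.log |t| ^ α := Real.rpow_pos_of_pos (Real.log_pos ht1) α
      set m : ℝ := M * (|t| * Real.log |t| ^ α) with hm
      have hm0 : 0 < m := by positivity
      have h1 : m * ‖x‖ ^ 2 ≤ quadForm (L t) x := by
        refine mul_norm_sq_le_quadForm (fun y hy => ?_) x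
        by_contra! hlt
        exact hz ⟨ht, y, hy, ((div_lt_iff₀ (by positivity)).2 hlt).le⟩
      have h2 : m⁻¹ ≤ w t + w (-t) := by
        have hRt : R < |t| := by linarith
        rcases le_total 0 t with h0 | h0
        · have : w t = m⁻¹ := by
            rw [abs_of_nonneg h0] at hRt
            rw [hw, Set.indicator_of_mem (Set.mem_Ioi.2 hRt), hm, abs_of_nonneg h0]
          linarith [hw0 (-t)]
        · have : w (-t) = m⁻¹ := by
            rw [abs_of_nonpos h0] at hRt
            rw [hw, Set.indicator_of_mem (Set.mem_Ioi.2 hRt), hm, abs_of_nonpos h0]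
          linarith [hw0 t]
      have h3 : m * ‖x‖ ^ 2 ≤ (inner ℝ (shiftedPotential L c t x) x : ℝ) := by
        rw [inner_shiftedPotential]
        nlinarith [mul_nonneg hc (sq_nonneg ‖x‖)]
      calc ‖x‖ ^ 2 = m⁻¹ * (m * ‖x‖ ^ 2) := by field_simp
        _ ≤ m⁻¹ * (inner ℝ (shiftedPotential L c t x) x : ℝ) := by gcongr
        _ ≤ _ := by
          refine mul_le_mul_of_nonneg_right ?_ hq0
          linarith [hz0 t]

end Coercivity

/-! ### Energy norm, spectral gap and the final assembly. -/

section Main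

theorem energyNorm_sq {X : Type*} [NormedAddCommGroup X] [InnerProductSpace ℝ X] [CompleteSpace X]
    (H B : X →ₗ.[ℝ] X) (u : B.domain) : energyNorm H B u ^ 2 =
      ‖B u‖ ^ 2 + ‖(nullSpace H).topologicalClosure.starProjection (u : X)‖ ^ 2 := by
  rw [energyNorm, Real.sq_sqrt (by positivity)]

theorem energyNorm_smul_sq {X : Type*} [NormedAddCommGroup X] [InnerProductSpace ℝ X]
    [CompleteSpace X] (H B : X →ₗ.[ℝ] X) (c : ℝ) (u : B.domain) :
    energyNorm H B (c • u) ^ 2 = c ^ 2 * energyNorm H B u ^ 2 := by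
  rw [energyNorm_sq, energyNorm_sq, LinearPMap.map_smul, Submodule.coe_smul, map_smul, norm_smul,
    norm_smul, mul_pow, mul_pow, Real.norm_eq_abs, sq_abs]
  ring

theorem norm_sub_sq_le {X : Type*} [NormedAddCommGroup X] [InnerProductSpace ℝ X] (x y : X) :
    ‖x - y‖ ^ 2 ≤ 2 * (‖x‖ ^ 2 + ‖y‖ ^ 2) := by
  have := parallelogram_law_with_norm ℝ x y
  nlinarith [sq_nonneg ‖x + y‖]

theorem energyNorm_sub_sq_le {X : Type*} [NormedAddCommGroup X] [InnerProductSpace ℝ X]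
    [CompleteSpace X] (H B : X →ₗ.[ℝ] X) (u v : B.domain) :
    energyNorm H B (u - v) ^ 2 ≤ 2 * (energyNorm H B u ^ 2 + energyNorm H B v ^ 2) := by
  rw [energyNorm_sq, energyNorm_sq, energyNorm_sq, LinearPMap.map_sub, Submodule.coe_sub, map_sub]
  have h1 := norm_sub_sq_le (B u) (B v)
  have h2 := norm_sub_sq_le ((nullSpace H).topologicalClosure.starProjection (u : X))
    ((nullSpace H).topologicalClosure.starProjection (v : X))
  linarith

/-- Only finitely many `ν i` satisfy `|ν i| ≤ |c| + 1`; all others are at distance at least `1` from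
`c`. -/
theorem exists_gap {ι : Type*} {ν : ι → ℝ} (h : ∀ K, {i | |ν i| ≤ K}.Finite) (c : ℝ) :
    ∃ δ : ℝ, 0 < δ ∧ ∀ i, ν i - c ≠ 0 → δ ≤ |ν i - c| := by
  have hfin : {i | |ν i| ≤ |c| + 1 ∧ ν i - c ≠ 0}.Finite :=
    (h (|c| + 1)).subset fun i hi => hi.1
  have hfar : ∀ i, ¬ |ν i| ≤ |c| + 1 → 1 ≤ |ν i - c| := by
    intro i hi
    have := abs_sub_abs_le_abs_sub (ν i) c
    linarith
  rcases Set.eq_empty_or_nonempty {i | |ν i| ≤ |c| + 1 ∧ ν i - c ≠ 0} with he | hne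
  · refine ⟨1, one_pos, fun i hi => hfar i fun h1 => ?_⟩
    have : i ∈ {i | |ν i| ≤ |c| + 1 ∧ ν i - c ≠ 0} := ⟨h1, hi⟩
    rw [he] at this
    exact this
  · obtain ⟨k, hk, hmin⟩ := Set.exists_min_image _ (fun i => |ν i - c|) hfin hne
    refine ⟨min 1 |ν k - c|, lt_min one_pos (abs_pos.2 hk.2), fun i hi => ?_⟩
    by_cases h1 : |ν i| ≤ |c| + 1
    · exact (min_le_right _ _).trans (hmin i ⟨h1, hi⟩)
    · exact (min_le_left _ _).trans (hfar i h1)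

theorem coeFn_schrodingerOp_sub {N : ℕ} {L : ℝ → Matrix (Fin N) (Fin N) ℝ} {c : ℝ}
    (hQ : Continuous (shiftedPotential L c)) (φ : testSpace (EuclideanSpace ℝ (Fin N))) :
    ((schrodingerOp hQ φ - c • testToL2 _ φ : L2Space N) : ℝ → EuclideanSpace ℝ (Fin N))
      =ᵐ[volume] fun t =>
        -deriv (deriv φ.1) t + Matrix.toEuclideanCLM (𝕜 := ℝ) (L t) (φ.1 t) := by
  filter_upwards [Lp.coeFn_sub (schrodingerOp hQ φ) (c • testToL2 _ φ),
    Lp.coeFn_smul c (testToL2 _ φ), coeFn_schrodingerOp hQ φ, coeFn_testToL2 φ] with t h1 h2 h3 h4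
  rw [h1, Pi.sub_apply, h2, Pi.smul_apply, h3, h4, shiftedPotential_apply]
  abel

theorem isSelfAdjointExtension_iff {N : ℕ} {L : ℝ → Matrix (Fin N) (Fin N) ℝ} {c : ℝ}
    (hQ : Continuous (shiftedPotential L c)) (H : L2Space N →ₗ.[ℝ] L2Space N) :
    IsSelfAdjointExtension L H ↔ IsSelfAdjoint H ∧ ∀ φ : testSpace (EuclideanSpace ℝ (Fin N)),
      (testToL2 _ φ, schrodingerOp hQ φ - c • testToL2 _ φ) ∈ H.graph := by
  refine and_congr_right fun _ => ⟨fun h φ => ?_, fun h φ h1 h2 => ?_⟩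
  · obtain ⟨u, hu1, hu2⟩ := h φ.1 φ.2.1 φ.2.2
    refine (LinearPMap.mem_graph_iff _).2 ⟨u, ?_, ?_⟩
    · exact Lp.ext (hu1.trans (coeFn_testToL2 φ).symm)
    · exact Lp.ext (hu2.trans (coeFn_schrodingerOp_sub hQ φ).symm)
  · obtain ⟨u, hu1, hu2⟩ := (LinearPMap.mem_graph_iff _).1 (h ⟨φ, h1, h2⟩)
    dsimp only at hu1 hu2
    refine ⟨u, ?_, ?_⟩
    · rw [hu1]
      exact coeFn_testToL2 (⟨φ, h1, h2⟩ : testSpace (EuclideanSpace ℝ (Fin N)))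
    · rw [hu2]
      exact coeFn_schrodingerOp_sub hQ (⟨φ, h1, h2⟩ : testSpace (EuclideanSpace ℝ (Fin N)))

end Main

theorem lemma2p1 (N : ℕ) (L : ℝ → Matrix (Fin N) (Fin N) ℝ) (hLcont : Continuous L)
    (hLsymm : ∀ t, (L t).IsSymm) (hL1 : CoercivityCondition L) (hL2 : LowerBoundCondition L) :
    (∃ H P B : L2Space N →ₗ.[ℝ] L2Space N,
      IsSelfAdjointExtension L H ∧ IsOperatorAbs H P ∧ IsOperatorSqrt P B) ∧
    ∀ H P B : L2Space N →ₗ.[ℝ] L2Space N,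
      IsSelfAdjointExtension L H → IsOperatorAbs H P → IsOperatorSqrt P B →
      ∀ (p : ℝ≥0∞) [Fact (1 ≤ p)],
        ∃ ι : B.domain →ₗ[ℝ] Lp (EuclideanSpace ℝ (Fin N)) p (volume : Measure ℝ),
          (∀ u : B.domain, (ι u : ℝ → EuclideanSpace ℝ (Fin N)) =ᵐ[volume]
            ((u : L2Space N) : ℝ → EuclideanSpace ℝ (Fin N))) ∧
          (∃ C : ℝ, 0 < C ∧ ∀ u : B.domain, ‖ι u‖ ≤ C * energyNorm H B u) ∧
          (∀ r : ℝ, IsCompact (closure (ι '' {u : B.domain | energyNorm H B u ≤ r}))) := by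
  obtain ⟨L₀, hL₀, hlower⟩ := hL2
  -- The extra `1` turns the lower bound (L2) into `(Qx, x) ≥ |x|²`.
  set c := L₀ + 1 with hc
  have hc0 : 0 < c := by positivity
  have hQ := continuous_shiftedPotential hLcont c
  have hpos : ∀ t x, ‖x‖ ^ 2 ≤ (inner ℝ (shiftedPotential L c t x) x : ℝ) := by
    intro t x
    rw [inner_shiftedPotential, hc]
    linarith [hlower t x]
  have hsymm := shiftedPotential_symm hLsymm c
  have htail := hL1.tailCoercive hc0.le hpos
  have hW := totallyBounded_form_ball hQ hpos htail
  obtain ⟨κ, b, ν, hweak, hfin, hball⟩ := exists_spectral_decomposition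
    (testToL2 (EuclideanSpace ℝ (Fin N))) (schrodingerOp hQ)
    (denseRange_schrodingerOp hQ hsymm hpos) denseRange_testToL2
    (inner_schrodingerOp_symm hQ hsymm) (norm_sq_le_form hQ hpos) hW
  refine ⟨⟨diagOp b fun i => ν i - c, diagOp b fun i => |ν i - c|, diagOp b fun i => √|ν i - c|,
    (isSelfAdjointExtension_iff hQ _).2 ⟨isSelfAdjoint_diagOp _ _, fun φ => ?_⟩,
    isOperatorAbs_diagOp _ _, isOperatorSqrt_diagOp _ fun i => abs_nonneg _⟩, ?_⟩
  · refine (mem_graph_diagOp ..).2 fun i => ?_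
    rw [inner_sub_right, inner_smul_right,
      hweak _ _ fun ψ => (inner_schrodingerOp_symm hQ hsymm φ ψ).symm]
    ring
  intro H P B hH hP hB p _
  obtain ⟨hHsa, hHtest⟩ := (isSelfAdjointExtension_iff hQ H).1 hH
  have hb : ∀ i, (b i, (ν i - c) • b i) ∈ H.graph := by
    refine basis_mem_graph_of_coord hHsa b fun u v huv i => ?_
    -- Self-adjointness of `H` against test functions makes `u` a weak solution of `A u = v + c u`,
    -- so its coordinates obey `ν i (b i, u) = (b i, v) + c (b i, u)`.
    have h1 := hweak u (v + c • u) (fun ψ => by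
      have h2 := inner_comm_of_isSelfAdjoint hHsa huv (hHtest ψ)
      rw [inner_sub_right, inner_smul_right] at h2
      rw [inner_add_left, inner_smul_left, conj_trivial]
      linarith) i
    rw [inner_add_right, inner_smul_right] at h1
    linarith
  obtain ⟨δ, hδ, hgap⟩ := exists_gap hfin c
  set K := 1 + c / δ + c with hK
  have hK0 : 0 < K := by positivity
  -- The factor `K` is the constant by which the squared energy norm bounds `∑ ν i (b i, u)²`, so `q
  -- u < 1` places `u` in the closed form ball.
  obtain ⟨ι, hι, ⟨C, hC, hCι⟩, hcompact⟩ := exists_compact_embedding (p := p) (D := B.domain)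
    (q := fun u => K * energyNorm H B u ^ 2)
    (fun a u => by rw [energyNorm_smul_sq]; ring)
    (fun u v => by
      have := mul_le_mul_of_nonneg_left (energyNorm_sub_sq_le H B u v) hK0.le
      linarith)
    hW
    (fun u hu => hball u _ hu fun F => by
      have := sum_le_energyNorm_sq hP hB b hb hδ hc0.le hgap u F
      simpa only [sub_add_cancel] using this)
    (fun ε hε => exists_eLpNorm_le_of_mem_closure hQ hpos htail Fact.out hε)
  refine ⟨ι, hι, ⟨C * √K, by positivity, fun u => ?_⟩, fun r => ?_⟩
  · have := hCι u
    rwa [Real.sqrt_mul hK0.le, Real.sqrt_sq (by exact Real.sqrt_nonneg _), ← mul_assoc] at this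
  · refine (hcompact (K * r ^ 2)).of_isClosed_subset isClosed_closure
      (closure_mono (Set.image_mono fun u hu => ?_))
    exact mul_le_mul_of_nonneg_left (pow_le_pow_left₀ (Real.sqrt_nonneg _) hu 2) hK0.le
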